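/- For all real constants $\varepsilon>0$ and $d\ge 1$ there is a randomized algorithm with the following property. Let $n\ge 2$ be an integer and let $\tilde G=(\tilde V,\tilde E)$ be a directed acyclic graph with $1\le|\tilde V|\le n$, given, together with $n$, as a list of its edges in arbitrary order. For $v\in\tilde V$ let $A(v)=\{u\in\tilde V:\text{there is a directed path (possibly of length }0)\text{ from }u\text{ to }v\}$ be the set of ancestors of $v$, including $v$ itself, and let $E(v)=\{(x,y)\in\tilde E: x,y\in A(v)\}$ be the set of edges of the subgraph induced by $A(v)$. On a word RAM with words of $O(\log n)$ bits, which can draw a uniformly random word in one step, the algorithm always halts within $O\big((|\tilde V|+|\tilde E|)\log^2 n\big)$ steps and returns integers $\hat a(v)$ and $\hat e(v)$ for every $v\in\tilde V$ such that, with probability at least $1-\frac1{n^d}$, simultaneously for all $v\in\tilde V$, $$(1-\varepsilon)\,|A(v)|\le \hat a(v)\le(1+\varepsilon)\,|A(v)|\quad\text{and}\quad(1-\varepsilon)\,|E(v)|\le\hat e(v)\le(1+\varepsilon)\,|E(v)|.$$ The constants hidden in the $O$-notation depend only on $\varepsilon$ and $d$. -/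

import Mathlib

/-! ### A randomized word RAM with a step count

Words of length `w` are the natural numbers below `2 ^ w`. A program is a structured program over
registers and a word-addressed memory; every arithmetic operation, memory access, assignment,
branching decision and draw of a random word costs one step. -/

namespace WordRAM

/-- The binary operations of the machine. -/
inductive BinOp where
  | add | sub | mul | div | mod | land | lor | lxor | shl | shr | lt | eq

/-- Value of a binary operation on words of length `w`: arithmetic is modulo `2 ^ w`, division by
`0` returns `0`, the remainder modulo `0` is the dividend, comparisons return `1` or `0`. -/
def BinOp.apply (w : ℕ) : BinOp → ℕ → ℕ → ℕ
  | .add, a, b => (a + b) % 2 ^ w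
  | .sub, a, b => (a + 2 ^ w - b) % 2 ^ w
  | .mul, a, b => (a * b) % 2 ^ w
  | .div, a, b => a / b
  | .mod, a, b => a % b
  | .land, a, b => a &&& b
  | .lor, a, b => a ||| b
  | .lxor, a, b => a ^^^ b
  | .shl, a, b => (a <<< b) % 2 ^ w
  | .shr, a, b => a >>> b
  | .lt, a, b => if a < b then 1 else 0
  | .eq, a, b => if a = b then 1 else 0

/-- Expressions: a constant, the content of a register, the content of the memory cell whose
address is the value of an expression, or a binary operation. -/
inductive Expr where
  | const (k : ℕ)
  | reg (i : ℕ)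
  | load (address : Expr)
  | bin (op : BinOp) (e₁ e₂ : Expr)

/-- A configuration: registers, memory, and the number of random words drawn so far. -/
structure State where
  regs : ℕ → ℕ
  mem : ℕ → ℕ
  drawn : ℕ

/-- Value of an expression. -/
def Expr.value (w : ℕ) (s : State) : Expr → ℕ
  | .const k => k % 2 ^ w
  | .reg i => s.regs i
  | .load e => s.mem (e.value w s)
  | .bin op e₁ e₂ => op.apply w (e₁.value w s) (e₂.value w s)

/-- Number of steps needed to evaluate an expression: one for each of its nodes. -/
def Expr.cost : Expr → ℕ
  | .const _ => 1
  | .reg _ => 1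
  | .load e => e.cost + 1
  | .bin _ e₁ e₂ => e₁.cost + e₂.cost + 1

/-- Programs. -/
inductive Prog where
  | skip
  | assign (i : ℕ) (e : Expr)
  | store (address e : Expr)
  | random (i : ℕ)
  | seq (p q : Prog)
  | cond (b : Expr) (p q : Prog)
  | loop (b : Expr) (p : Prog)

/-- `Exec w ω p s T t`: with word length `w` and random words `ω 0, ω 1, …`, the program `p`
started in configuration `s` halts after exactly `T` steps in configuration `t`. The instruction
`cond b p q` runs `p` if `b` has a nonzero value and `q` otherwise, `loop b p` runs `p` as long as
`b` has a nonzero value, and `random i` puts the next random word into register `i`. -/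
inductive Exec (w : ℕ) (ω : ℕ → Fin (2 ^ w)) : Prog → State → ℕ → State → Prop
  | skip (s : State) : Exec w ω .skip s 1 s
  | assign (i : ℕ) (e : Expr) (s : State) :
      Exec w ω (.assign i e) s (e.cost + 1)
        { s with regs := Function.update s.regs i (e.value w s) }
  | store (a e : Expr) (s : State) :
      Exec w ω (.store a e) s (a.cost + e.cost + 1)
        { s with mem := Function.update s.mem (a.value w s) (e.value w s) }
  | random (i : ℕ) (s : State) :
      Exec w ω (.random i) s 1
        { s with regs := Function.update s.regs i (ω s.drawn : ℕ), drawn := s.drawn + 1 }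
  | seq {p q : Prog} {s t u : State} {T₁ T₂ : ℕ} :
      Exec w ω p s T₁ t → Exec w ω q t T₂ u → Exec w ω (.seq p q) s (T₁ + T₂) u
  | condTrue {b : Expr} {p q : Prog} {s t : State} {T : ℕ} :
      b.value w s ≠ 0 → Exec w ω p s T t → Exec w ω (.cond b p q) s (b.cost + 1 + T) t
  | condFalse {b : Expr} {p q : Prog} {s t : State} {T : ℕ} :
      b.value w s = 0 → Exec w ω q s T t → Exec w ω (.cond b p q) s (b.cost + 1 + T) t
  | loopTrue {b : Expr} {p : Prog} {s t u : State} {T₁ T₂ : ℕ} :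
      b.value w s ≠ 0 → Exec w ω p s T₁ t → Exec w ω (.loop b p) t T₂ u →
      Exec w ω (.loop b p) s (b.cost + 1 + T₁ + T₂) u
  | loopFalse {b : Expr} {p : Prog} {s : State} :
      b.value w s = 0 → Exec w ω (.loop b p) s (b.cost + 1) s

/-- The law of a sequence of independent uniformly distributed random words of length `w`. -/
noncomputable def randomWords (w : ℕ) : MeasureTheory.Measure (ℕ → Fin (2 ^ w)) :=
  MeasureTheory.Measure.infinitePi fun _ : ℕ => (PMF.uniformOfFintype (Fin (2 ^ w))).toMeasure

/-- The configuration in which the cells `0, 1, 2, …` of the memory hold the words of the list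
`input` and all other cells and all registers are `0`. -/
def initial (w : ℕ) (input : List ℕ) : State where
  regs := fun _ => 0
  mem := fun i => input.getD i 0 % 2 ^ w
  drawn := 0

end WordRAM

/-! ### Directed acyclic graphs, ancestors and induced edges -/

namespace Digraph

/-- No directed closed walk of positive length. -/
def IsDAG {V : Type*} (G : Digraph V) : Prop :=
  ∀ v, ¬ Relation.TransGen G.Adj v v

/-- The ancestors of `v`, including `v` itself. -/
def ancestors {V : Type*} (G : Digraph V) (v : V) : Set V :=
  {u | Relation.ReflTransGen G.Adj u v}

/-- The edges of the subgraph induced by the ancestors of `v`. -/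
def ancestorEdges {V : Type*} (G : Digraph V) (v : V) : Set (V × V) :=
  {e | G.Adj e.1 e.2 ∧ e.1 ∈ G.ancestors v ∧ e.2 ∈ G.ancestors v}

/-- `L` lists every edge of `G` exactly once, in an arbitrary order. -/
def IsEdgeList {V : Type*} (G : Digraph V) (L : List (V × V)) : Prop :=
  L.Nodup ∧ ∀ u v, (u, v) ∈ L ↔ G.Adj u v

end Digraph

/-- The input of the algorithm: the numbers `n`, `|V|` and `|E|`, followed by the two end points
(tail, then head) of each edge. The vertices are `0, …, N - 1`. -/
def encodeInput (n N : ℕ) (L : List (Fin N × Fin N)) : List ℕ :=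
  n :: N :: L.length :: L.flatMap fun e => [(e.1 : ℕ), (e.2 : ℕ)]

/-- `x` is an estimate of `a` up to a factor `1 ± ε`. -/
def IsEstimate (ε : ℝ) (a x : ℕ) : Prop :=
  (1 - ε) * a ≤ x ∧ x ≤ (1 + ε) * a

/-- The content `t` of the machine at the end of a run is a correct output for `G`: register `0`
holds the address of an array with an estimate of the number of ancestors of each vertex, and
register `1` the address of an array with an estimate of the number of edges that they induce. -/
def CorrectOutput (ε : ℝ) {N : ℕ} (G : Digraph (Fin N)) (t : WordRAM.State) : Prop :=
  ∀ v : Fin N,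
    IsEstimate ε (G.ancestors v).ncard (t.mem (t.regs 0 + v)) ∧
    IsEstimate ε (G.ancestorEdges v).ncard (t.mem (t.regs 1 + v))

/-!
Sample every vertex independently with probability `2⁻ⁱ`. A vertex with `a` ancestors is reached
from the sample with probability `1 - (1 - 2⁻ⁱ) ^ a`, which is close to `a / 2ⁱ` as soon as this
quotient is small. By Hoeffding's inequality, `O(log n)` rounds at each of the levels
`i = 0, …, O(log n)` determine all these probabilities up to a small constant, except with
probability `n⁻ᵈ`. The largest level at which `v` is reached in a constant fraction of the rounds
therefore reveals `a` up to a factor `1 ± ε`, and rounding to the nearest integer makes the estimate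
exact for small `a`. An edge is induced by the ancestors of `v` if and only if its head is an
ancestor of `v`, so sampling the heads of edges estimates the number of these edges in the same way.
Each round is one graph search from the sampled vertices, in linear time.
-/

namespace WordRAM

/-- The two kinds of items that are sampled. Sampling vertices estimates the numbers of ancestors,
sampling edges estimates the numbers of edges between ancestors. -/
inductive ItemKind where
  | vertex | edge
deriving DecidableEq

/-- Names of the registers; register `output k` finally holds the address of the estimates for the
items of kind `k`. -/
inductive Var where
  | output (k : ItemKind)
  | stride | vertexCount | edgeCount | size | reps | levels | threshold
  | level | rep | pos | scale | word | vertex | queueLen | queueHead | edge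
deriving DecidableEq

/-- The number of a named register. -/
def Var.index : Var → ℕ
  | .output .vertex => 0 | .output .edge => 1
  | .stride => 2 | .vertexCount => 3 | .edgeCount => 4 | .size => 5 | .reps => 6 | .levels => 7
  | .threshold => 8 | .level => 9 | .rep => 10 | .pos => 11 | .scale => 12 | .word => 13
  | .vertex => 14 | .queueLen => 15 | .queueHead => 16 | .edge => 17

theorem Var.index_injective : Function.Injective Var.index := by
  rintro (⟨_ | _⟩ | _) (⟨_ | _⟩ | _) h <;> first | rfl | cases h

/-- Names of the arrays, which are consecutive memory blocks of equal length. The input starts at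
address `0`. -/
inductive Arr where
  | estimate (k : ItemKind)
  | input | first | next | mark | queue | hits
deriving DecidableEq

/-- The number of the memory block that holds an array. -/
def Arr.index : Arr → ℕ
  | .input => 0 | .first => 1 | .next => 2 | .mark => 3 | .queue => 4 | .hits => 5
  | .estimate .vertex => 6 | .estimate .edge => 7

theorem Arr.index_injective : Function.Injective Arr.index := by
  rintro (⟨_ | _⟩ | _) (⟨_ | _⟩ | _) h <;> first | rfl | cases h

theorem Arr.index_lt : ∀ a : Arr, a.index < 8 := by
  rintro (⟨_ | _⟩ | _) <;> decide

/-- The content of a named register. -/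
def State.var (s : State) (v : Var) : ℕ := s.regs v.index

/-- The configuration with the content of register `v` replaced by `x`. -/
def State.set (s : State) (v : Var) (x : ℕ) : State :=
  { s with regs := Function.update s.regs v.index x }

/-- The configuration after the random word `x` has been drawn into register `v`. -/
def State.draw (s : State) (v : Var) (x : ℕ) : State :=
  { s.set v x with drawn := s.drawn + 1 }

/-- Entry `x` of array `a`, where the arrays have length `S`. -/
def State.arr (s : State) (S : ℕ) (a : Arr) (x : ℕ) : ℕ := s.mem (a.index * S + x)

/-- The configuration with entry `x` of array `a` replaced by `y`, where the arrays have length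
`S`. -/
def State.put (s : State) (S : ℕ) (a : Arr) (x y : ℕ) : State :=
  { s with mem := Function.update s.mem (a.index * S + x) y }

section State

variable (s : State) (S : ℕ) (v : Var) (a : Arr) (x y : ℕ)

@[simp] theorem State.var_set (u : Var) : (s.set v x).var u = if u = v then x else s.var u := by
  simp [State.var, State.set, Function.update_apply, Var.index_injective.eq_iff]

@[simp] theorem State.var_draw (u : Var) : (s.draw v x).var u = if u = v then x else s.var u :=
  s.var_set v x u

@[simp] theorem State.arr_set : (s.set v x).arr = s.arr := rfl

variable {s S a x y}

theorem index_mul_add_inj {b : Arr} {z : ℕ} (hx : x < S) (hz : z < S) :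
    b.index * S + z = a.index * S + x ↔ b = a ∧ z = x := by
  constructor
  · intro h
    have hdiv : ∀ i r, r < S → (i * S + r) / S = i := fun i r hr => by
      rw [add_comm, Nat.add_mul_div_right _ _ (by omega), Nat.div_eq_of_lt hr, zero_add]
    have hab : b.index = a.index := by rw [← hdiv b.index z hz, h, hdiv a.index x hx]
    exact ⟨Arr.index_injective hab, by rw [hab] at h; omega⟩
  · rintro ⟨rfl, rfl⟩
    rfl

theorem State.arr_put {b : Arr} {z : ℕ} (hx : x < S) (hz : z < S) :
    (s.put S a x y).arr S b z = if b = a ∧ z = x then y else s.arr S b z := by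
  simp [State.arr, State.put, Function.update_apply, index_mul_add_inj hx hz]

end State

/-- The configurations `s` and `t` agree except for the registers `vs` and the arrays `as`, and `k`
random words have been drawn between them. -/
structure Frame (S : ℕ) (vs : List Var) (as : List Arr) (k : ℕ) (s t : State) : Prop where
  var_of_notMem : ∀ v ∉ vs, t.var v = s.var v
  arr_of_notMem : ∀ a ∉ as, ∀ x < S, t.arr S a x = s.arr S a x
  drawn : t.drawn = s.drawn + k

namespace Frame

variable {S : ℕ} {vs vs' : List Var} {as as' : List Arr} {j k : ℕ} {s t u : State}

theorem var (h : Frame S vs as k s t) (v : Var) (hv : v ∉ vs := by simp) : t.var v = s.var v :=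
  h.var_of_notMem v hv

theorem arr (h : Frame S vs as k s t) (a : Arr) {x : ℕ} (hx : x < S) (ha : a ∉ as := by simp) :
    t.arr S a x = s.arr S a x :=
  h.arr_of_notMem a ha x hx

theorem refl (S : ℕ) (vs : List Var) (as : List Arr) (s : State) : Frame S vs as 0 s s :=
  ⟨fun _ _ => rfl, fun _ _ _ _ => rfl, rfl⟩

theorem trans (h : Frame S vs as j s t) (h' : Frame S vs as k t u) : Frame S vs as (j + k) s u :=
  ⟨fun v hv => (h'.var v hv).trans (h.var v hv),
    fun a ha _ hx => (h'.arr a hx ha).trans (h.arr a hx ha), by rw [h'.drawn, h.drawn, add_assoc]⟩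

theorem mono (h : Frame S vs as k s t) (hvs : vs ⊆ vs' := by simp) (has : as ⊆ as' := by simp) :
    Frame S vs' as' k s t :=
  ⟨fun v hv => h.var v (mt (@hvs v) hv), fun a ha _ hx => h.arr a hx (mt (@has a) ha), h.drawn⟩

theorem set (h : Frame S vs as k s t) (v : Var) (x : ℕ) (hv : v ∈ vs := by simp) :
    Frame S vs as k s (t.set v x) :=
  ⟨fun u hu => by
    rw [State.var_set, if_neg (ne_of_mem_of_not_mem hv hu).symm, h.var u hu], h.arr_of_notMem,
    h.drawn⟩

theorem draw (h : Frame S vs as k s t) (v : Var) (x : ℕ) (hv : v ∈ vs := by simp) :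
    Frame S vs as (k + 1) s (t.draw v x) :=
  ⟨(h.set v x hv).var_of_notMem, h.arr_of_notMem, congrArg (· + 1) h.drawn⟩

theorem put (h : Frame S vs as k s t) (a : Arr) {x y : ℕ} (hx : x < S) (ha : a ∈ as := by simp) :
    Frame S vs as k s (t.put S a x y) :=
  ⟨h.var_of_notMem, fun b hb z hz => by
    rw [State.arr_put hx hz, if_neg fun h' => ne_of_mem_of_not_mem ha hb h'.1.symm, h.arr b hz hb],
    h.drawn⟩

end Frame

instance (n : ℕ) : OfNat Expr n := ⟨.const n⟩

instance : Add Expr := ⟨.bin .add⟩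

instance : Sub Expr := ⟨.bin .sub⟩

instance : Mul Expr := ⟨.bin .mul⟩

instance : Div Expr := ⟨.bin .div⟩

instance : Mod Expr := ⟨.bin .mod⟩

/-- The content of a named register. -/
def Expr.var (v : Var) : Expr := .reg v.index

/-- The address of an entry of an array. -/
def Expr.adr (a : Arr) (e : Expr) : Expr := .const a.index * .var .stride + e

/-- An entry of an array. -/
def Expr.arr (a : Arr) (e : Expr) : Expr := .load (.adr a e)

/-- Assignment to a named register. -/
def Prog.set (v : Var) (e : Expr) : Prog := .assign v.index e

/-- Assignment to an entry of an array. -/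
def Prog.put (a : Arr) (e₁ e₂ : Expr) : Prog := .store (.adr a e₁) e₂

/-- A random word is drawn into a named register. -/
def Prog.draw (v : Var) : Prog := .random v.index

infixr:60 ";;" => Prog.seq

/-- Run `body` with register `i` counting from `0` up to the content of register `b`. -/
def Prog.count (i b : Var) (body : Prog) : Prog :=
  .set i 0 ;; .loop (.bin .lt (.var i) (.var b)) (body ;; .set i (.var i + 1))

section Values

variable {w : ℕ} {s : State} {e e₁ e₂ : Expr} {x y : ℕ}

theorem Expr.value_var {v : Var} (h : s.var v = x) : (Expr.var v).value w s = x := h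

theorem Expr.value_const {k : ℕ} (h : k < 2 ^ w) : (Expr.const k).value w s = k :=
  Nat.mod_eq_of_lt h

theorem Expr.value_ofNat {k : ℕ} (h : k < 2 ^ w) : (OfNat.ofNat k : Expr).value w s = k :=
  Nat.mod_eq_of_lt h

theorem Expr.value_add (h₁ : e₁.value w s = x) (h₂ : e₂.value w s = y) (h : x + y < 2 ^ w) :
    (e₁ + e₂).value w s = x + y := by
  subst h₁ h₂
  exact Nat.mod_eq_of_lt h

theorem Expr.value_sub (h₁ : e₁.value w s = x) (h₂ : e₂.value w s = y) (hyx : y ≤ x)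
    (h : x < 2 ^ w) : (e₁ - e₂).value w s = x - y := by
  subst h₁ h₂
  change (_ + 2 ^ w - _) % 2 ^ w = _
  rw [Nat.sub_add_comm hyx, Nat.add_mod_right, Nat.mod_eq_of_lt (by omega)]

theorem Expr.value_mul (h₁ : e₁.value w s = x) (h₂ : e₂.value w s = y) (h : x * y < 2 ^ w) :
    (e₁ * e₂).value w s = x * y := by
  subst h₁ h₂
  exact Nat.mod_eq_of_lt h

theorem Expr.value_div (h₁ : e₁.value w s = x) (h₂ : e₂.value w s = y) :
    (e₁ / e₂).value w s = x / y := by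
  subst h₁ h₂
  rfl

theorem Expr.value_mod (h₁ : e₁.value w s = x) (h₂ : e₂.value w s = y) :
    (e₁ % e₂).value w s = x % y := by
  subst h₁ h₂
  rfl

theorem Expr.value_shl_one (he : e.value w s = x) (h : x < w) :
    (Expr.bin .shl 1 e).value w s = 2 ^ x := by
  subst he
  change ((1 % 2 ^ w) <<< _) % 2 ^ w = _
  rw [Nat.mod_eq_of_lt (Nat.one_lt_two_pow (by omega)), Nat.shiftLeft_eq, one_mul,
    Nat.mod_eq_of_lt (Nat.pow_lt_pow_right one_lt_two h)]

theorem Expr.value_lt_ne_zero :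
    (Expr.bin .lt e₁ e₂).value w s ≠ 0 ↔ e₁.value w s < e₂.value w s := by
  simp [Expr.value, BinOp.apply]

theorem Expr.value_lor_ne_zero :
    (Expr.bin .lor e₁ e₂).value w s ≠ 0 ↔ e₁.value w s ≠ 0 ∨ e₂.value w s ≠ 0 := by
  simp [Expr.value, BinOp.apply, Nat.or_eq_zero_iff, imp_iff_not_or]

end Values

/-- The arrays have length `S` and their addresses are words of length `w`. -/
structure Layout (w S : ℕ) (s : State) : Prop where
  stride : s.var .stride = S
  fits : 8 * S ≤ 2 ^ w

namespace Layout

variable {w S : ℕ} {s t : State} {e : Expr} {x : ℕ}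

theorem of_frame {vs : List Var} {as : List Arr} {k : ℕ} (h : Layout w S s)
    (hf : Frame S vs as k s t)
    (hv : .stride ∉ vs := by simp) : Layout w S t :=
  ⟨(hf.var .stride hv).trans h.stride, h.fits⟩

theorem value_adr (h : Layout w S s) (a : Arr) (he : e.value w s = x) (hx : x < S) :
    (Expr.adr a e).value w s = a.index * S + x := by
  have hblock : (a.index + 1) * S ≤ 8 * S := Nat.mul_le_mul_right _ a.index_lt
  have hfits := h.fits
  rw [add_one_mul] at hblock
  have hindex : a.index ≤ a.index * S := Nat.le_mul_of_pos_right _ (by omega)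
  exact Expr.value_add (Expr.value_mul (Expr.value_const (by omega)) h.stride (by omega)) he
    (by omega)

theorem value_arr (h : Layout w S s) (a : Arr) (he : e.value w s = x) (hx : x < S) :
    (Expr.arr a e).value w s = s.arr S a x := by
  rw [Expr.arr, Expr.value, h.value_adr a he hx, State.arr]

end Layout

section Run

variable {w : ℕ} {ω : ℕ → Fin (2 ^ w)} {p q : Prog} {s : State} {B B' : ℕ} {Q Q' : State → Prop}

/-- The program halts within `B` steps in a configuration that satisfies `Q`. -/
def Run (w : ℕ) (ω : ℕ → Fin (2 ^ w)) (p : Prog) (s : State) (B : ℕ) (Q : State → Prop) : Prop :=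
  ∃ T t, Exec w ω p s T t ∧ T ≤ B ∧ Q t

theorem Run.mono (h : Run w ω p s B Q) (hB : B ≤ B') (hQ : ∀ t, Q t → Q' t) :
    Run w ω p s B' Q' := by
  obtain ⟨T, t, hexec, hT, ht⟩ := h
  exact ⟨T, t, hexec, hT.trans hB, hQ t ht⟩

theorem Run.seq {B₁ B₂ : ℕ} (h : Run w ω p s B₁ Q') (h' : ∀ t, Q' t → Run w ω q t B₂ Q) :
    Run w ω (p ;; q) s (B₁ + B₂) Q := by
  obtain ⟨T, t, hexec, hT, ht⟩ := h
  obtain ⟨T', t', hexec', hT', ht'⟩ := h' t ht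
  exact ⟨T + T', t', .seq hexec hexec', Nat.add_le_add hT hT', ht'⟩

/-- A loop whose invariant carries a bound `k` on the number of remaining iterations. -/
theorem Run.loop {b : Expr} (Inv : ℕ → State → Prop) {k : ℕ} (init : Inv k s)
    (step : ∀ k t, Inv k t → b.value w t ≠ 0 → Run w ω p t B fun u => ∃ j < k, Inv j u)
    (done : ∀ k t, Inv k t → b.value w t = 0 → Q t) :
    Run w ω (.loop b p) s (k * (B + b.cost + 1) + b.cost + 1) Q := by
  induction k using Nat.strong_induction_on generalizing s with
  | _ k ih =>
    by_cases hb : b.value w s = 0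
    · exact ⟨_, s, .loopFalse hb, by omega, done k s init hb⟩
    obtain ⟨T, t, hexec, hT, j, hj, ht⟩ := step k s init hb
    obtain ⟨T', t', hexec', hT', ht'⟩ := ih j hj ht
    have hmul : (j + 1) * (B + b.cost + 1) ≤ k * (B + b.cost + 1) := Nat.mul_le_mul_right _ hj
    rw [add_one_mul] at hmul
    exact ⟨_, t', .loopTrue hb hexec hexec', by omega, ht'⟩

/-- The weakest precondition of a program without loops; `False` at a loop. -/
def Prog.wp (w : ℕ) (ω : ℕ → Fin (2 ^ w)) : Prog → (State → Prop) → State → Prop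
  | .skip, Q, s => Q s
  | .assign i e, Q, s => Q { s with regs := Function.update s.regs i (e.value w s) }
  | .store a e, Q, s => Q { s with mem := Function.update s.mem (a.value w s) (e.value w s) }
  | .random i, Q, s =>
      Q { s with regs := Function.update s.regs i (ω s.drawn : ℕ), drawn := s.drawn + 1 }
  | .seq p q, Q, s => p.wp w ω (q.wp w ω Q) s
  | .cond b p q, Q, s => (b.value w s ≠ 0 → p.wp w ω Q s) ∧ (b.value w s = 0 → q.wp w ω Q s)
  | .loop _ _, _, _ => False

/-- A bound on the number of steps of a program without loops. -/
def Prog.time : Prog → ℕ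
  | .skip => 1
  | .assign _ e => e.cost + 1
  | .store a e => a.cost + e.cost + 1
  | .random _ => 1
  | .seq p q => p.time + q.time
  | .cond b p q => b.cost + 1 + max p.time q.time
  | .loop _ _ => 0

theorem Run.of_wp (h : p.wp w ω Q s) (hB : p.time ≤ B) : Run w ω p s B Q := by
  suffices Run w ω p s p.time Q from this.mono hB fun _ => id
  clear hB
  induction p generalizing Q s with
  | skip => exact ⟨_, _, .skip s, le_rfl, h⟩
  | assign i e => exact ⟨_, _, .assign i e s, le_rfl, h⟩
  | store a e => exact ⟨_, _, .store a e s, le_rfl, h⟩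
  | random i => exact ⟨_, _, .random i s, le_rfl, h⟩
  | seq p q ihp ihq => exact (ihp h).seq fun _ ht => ihq ht
  | cond b p q ihp ihq =>
    by_cases hb : b.value w s = 0
    · obtain ⟨T, t, hexec, hT, ht⟩ := ihq (h.2 hb)
      exact ⟨_, t, .condFalse hb hexec, Nat.add_le_add_left (hT.trans (le_max_right _ _)) _, ht⟩
    · obtain ⟨T, t, hexec, hT, ht⟩ := ihp (h.1 hb)
      exact ⟨_, t, .condTrue hb hexec, Nat.add_le_add_left (hT.trans (le_max_left _ _)) _, ht⟩
  | loop b p => exact h.elim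

theorem Run.of_wp_seq (h : p.wp w ω (Run w ω q · B Q) s) : Run w ω (p ;; q) s (p.time + B) Q :=
  (Run.of_wp h le_rfl).seq fun _ => id

theorem wp_seq (h : p.wp w ω (q.wp w ω Q) s) : (p ;; q).wp w ω Q s := h

theorem wp_set {v : Var} {e : Expr} {x : ℕ} (he : e.value w s = x) (h : Q (s.set v x)) :
    (Prog.set v e).wp w ω Q s := by
  subst he
  exact h

theorem wp_put {S x y : ℕ} {a : Arr} {e₁ e₂ : Expr} (hs : Layout w S s) (h₁ : e₁.value w s = x)
    (hx : x < S) (h₂ : e₂.value w s = y) (h : Q (s.put S a x y)) :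
    (Prog.put a e₁ e₂).wp w ω Q s := by
  subst h₂
  rw [Prog.put, Prog.wp, hs.value_adr a h₁ hx]
  exact h

theorem wp_draw {v : Var} (h : Q (s.draw v (ω s.drawn))) : (Prog.draw v).wp w ω Q s := h

theorem Run.count {i b : Var} {n : ℕ} (Inv : ℕ → State → Prop) (hib : b ≠ i) (hn : n < 2 ^ w)
    (hb : s.var b = n) (init : Inv 0 (s.set i 0))
    (step : ∀ k < n, ∀ t, Inv k t → t.var i = k → Run w ω p t B fun u =>
      u.var i = k ∧ u.var b = t.var b ∧ Inv (k + 1) (u.set i (k + 1))) :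
    Run w ω (.count i b p) s (n * (B + 8) + 6) (Inv n) := by
  have hloop : Run w ω (.loop (.bin .lt (.var i) (.var b)) (p ;; .set i (.var i + 1))) (s.set i 0)
      (n * (B + 4 + 3 + 1) + 3 + 1) (Inv n) := by
    refine Run.loop (k := n)
      (fun k t => k ≤ n ∧ Inv (n - k) t ∧ t.var i = n - k ∧ t.var b = n) ?_ ?_ ?_
    · simp [init, hib, hb]
    · rintro k t ⟨hk, hinv, hi, hbt⟩ hlt
      rw [Expr.value_lt_ne_zero, Expr.value_var hi, Expr.value_var hbt] at hlt
      refine (step (n - k) (by omega) t hinv hi).seq ?_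
      rintro u ⟨hiu, hbu, hinv'⟩
      refine Run.of_wp (wp_set (x := n - k + 1) ?_ ⟨k - 1, by omega, by omega, ?_, ?_, ?_⟩) le_rfl
      · exact Expr.value_add hiu (Expr.value_ofNat (k := 1) (by omega)) (by omega)
      · rwa [show n - (k - 1) = n - k + 1 by omega]
      · simp only [State.var_set, ↓reduceIte]
        omega
      · simp [hib, hbu, hbt]
    · rintro k t ⟨hk, hinv, hi, hbt⟩ hlt
      rw [← not_ne_iff, Expr.value_lt_ne_zero, Expr.value_var hi, Expr.value_var hbt] at hlt
      obtain rfl : k = 0 := by omega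
      exact hinv
  exact (Run.of_wp_seq (wp_set (Expr.value_ofNat (by positivity)) hloop)).mono
    (by simp only [Prog.set, Prog.time, Expr.cost]; ring_nf; rfl) fun _ => id

end Run

end WordRAM

/-- A finite sequence of directed edges, the form in which the machine stores its input graph. -/
structure EdgeSeq where
  tail : ℕ → ℕ
  head : ℕ → ℕ
  size : ℕ

namespace EdgeSeq

variable {E : EdgeSeq} {l l₀ : List ℕ} {u v f k e qh : ℕ}

/-- The adjacency relation of a sequence of edges. -/
def Adj (E : EdgeSeq) (u v : ℕ) : Prop := ∃ f < E.size, E.tail f = u ∧ E.head f = v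

/-- One plus the index of the last of the first `k` edges with tail `u`, or `0` if there is none.
These numbers are the links of the adjacency lists. -/
def lastOut (E : EdgeSeq) (u : ℕ) : ℕ → ℕ
  | 0 => 0
  | k + 1 => if E.tail k = u then k + 1 else E.lastOut u k

theorem lastOut_le : ∀ k, E.lastOut u k ≤ k
  | 0 => le_rfl
  | k + 1 => by
    rw [lastOut]
    split_ifs
    exacts [le_rfl, (lastOut_le k).trans k.le_succ]

theorem tail_lastOut_sub_one : ∀ k, E.lastOut u k ≠ 0 → E.tail (E.lastOut u k - 1) = u
  | 0, h => absurd rfl h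
  | k + 1, h => by
    rw [lastOut] at h ⊢
    split_ifs at h ⊢ with hk
    exacts [hk, tail_lastOut_sub_one k h]

theorem lt_lastOut_and_tail_eq_iff :
    f < E.lastOut u k ∧ E.tail f = E.tail (E.lastOut u k - 1) ↔ f < k ∧ E.tail f = u := by
  constructor
  · rintro ⟨hf, htail⟩
    exact ⟨hf.trans_le (lastOut_le k), htail.trans (tail_lastOut_sub_one k (by omega))⟩
  · rintro ⟨hf, htail⟩
    have hlt : f < E.lastOut u k := by
      induction k with
      | zero => omega
      | succ k ih =>
        rw [lastOut]
        split_ifs with hk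
        · exact hf
        · exact ih ((Nat.lt_succ_iff.1 hf).lt_of_ne fun h => hk (h ▸ htail))
    exact ⟨hlt, htail.trans (tail_lastOut_sub_one k (by omega)).symm⟩

/-- Append `v` to the list `l` unless it already occurs in it. -/
def enqueue (l : List ℕ) (v : ℕ) : List ℕ := if v ∈ l then l else l ++ [v]

theorem mem_enqueue : u ∈ enqueue l v ↔ u ∈ l ∨ u = v := by
  rw [enqueue]
  split_ifs with h
  · exact ⟨.inl, fun hu => hu.elim id fun huv => huv ▸ h⟩
  · simp

theorem nodup_enqueue (h : l.Nodup) : (enqueue l v).Nodup := by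
  rw [enqueue]
  split_ifs with hv
  exacts [h, List.concat_eq_append ▸ h.concat hv]

theorem prefix_enqueue : l <+: enqueue l v := by
  rw [enqueue]
  split_ifs
  exacts [List.prefix_rfl, List.prefix_append l [v]]

/-- The edges that a graph search still has to scan: those whose tail is not among the first `qh`
vertices of the queue `l`, and those of the adjacency list that is being scanned, whose next link
is `e`. -/
def unscanned (E : EdgeSeq) (l : List ℕ) (qh e : ℕ) : Finset ℕ :=
  {f ∈ Finset.range E.size | E.tail f ∉ l.take qh ∨ f < e ∧ E.tail f = E.tail (e - 1)}

/-- Invariant of a graph search from the vertices of `l₀`: the queue is `l`, its first `qh` vertices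
have been removed, and `e` is the next link of the adjacency list that is being scanned. -/
structure SearchInv (E : EdgeSeq) (l₀ l : List ℕ) (qh e : ℕ) : Prop where
  nodup : l.Nodup
  removed_le : qh ≤ l.length
  edge_le : e ≤ E.size
  tail_mem : e ≠ 0 → E.tail (e - 1) ∈ l.take qh
  head_mem : ∀ f < E.size, f ∉ E.unscanned l qh e → E.head f ∈ l
  start_subset : l₀ ⊆ l
  reachable : ∀ v ∈ l, ∃ u ∈ l₀, Relation.ReflTransGen E.Adj u v

namespace SearchInv

theorem start (h : l.Nodup) : E.SearchInv l l 0 0 where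
  nodup := h
  removed_le := Nat.zero_le _
  edge_le := Nat.zero_le _
  tail_mem := absurd rfl
  head_mem f hf hf' := by simp [unscanned, hf] at hf'
  start_subset := List.Subset.refl l
  reachable v hv := ⟨v, hv, .refl⟩

theorem unscanned_remove (h : E.SearchInv l₀ l qh 0) (hqh : qh < l.length) :
    E.unscanned l (qh + 1) (E.lastOut l[qh] E.size) = E.unscanned l qh 0 := by
  have hnew : l[qh] ∉ l.take qh := by
    rw [List.mem_take_iff_getElem]
    rintro ⟨i, hi, heq⟩
    have := (h.nodup.getElem_inj_iff).1 heq
    omega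
  refine Finset.filter_congr fun f hf => ?_
  rw [lt_lastOut_and_tail_eq_iff, ← List.take_append_getElem hqh, List.mem_append,
    List.mem_singleton]
  have hf := Finset.mem_range.1 hf
  by_cases htail : E.tail f = l[qh] <;> simp [htail, hnew, hf]

theorem remove (h : E.SearchInv l₀ l qh 0) (hqh : qh < l.length) :
    E.SearchInv l₀ l (qh + 1) (E.lastOut l[qh] E.size) where
  nodup := h.nodup
  removed_le := hqh
  edge_le := lastOut_le _
  tail_mem he := by
    rw [tail_lastOut_sub_one _ he, List.mem_take_iff_getElem]
    exact ⟨qh, by omega, rfl⟩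
  head_mem := by
    rw [h.unscanned_remove hqh]
    exact h.head_mem
  start_subset := h.start_subset
  reachable := h.reachable

theorem unscanned_scan (h : E.SearchInv l₀ l qh e) (he : e ≠ 0) :
    E.unscanned (enqueue l (E.head (e - 1))) qh (E.lastOut (E.tail (e - 1)) (e - 1)) =
      (E.unscanned l qh e).erase (e - 1) := by
  have htake : (enqueue l (E.head (e - 1))).take qh = l.take qh := by
    obtain ⟨l', hl'⟩ := prefix_enqueue (l := l) (v := E.head (e - 1))
    rw [← hl', List.take_append_of_le_length h.removed_le]
  have htail := h.tail_mem he
  ext f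
  simp only [unscanned, Finset.mem_filter, Finset.mem_erase, lt_lastOut_and_tail_eq_iff, htake]
  by_cases hf : f = e - 1
  · simp [hf, htail]
  · have : f < e - 1 ↔ f < e := by omega
    simp [hf, this]

theorem mem_unscanned (h : E.SearchInv l₀ l qh e) (he : e ≠ 0) : e - 1 ∈ E.unscanned l qh e :=
  Finset.mem_filter.2 ⟨Finset.mem_range.2 (by have := h.edge_le; omega), .inr ⟨by omega, rfl⟩⟩

theorem scan (h : E.SearchInv l₀ l qh e) (he : e ≠ 0) :
    E.SearchInv l₀ (enqueue l (E.head (e - 1))) qh (E.lastOut (E.tail (e - 1)) (e - 1)) where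
  nodup := nodup_enqueue h.nodup
  removed_le := h.removed_le.trans prefix_enqueue.length_le
  edge_le := (lastOut_le _).trans ((Nat.sub_le _ _).trans h.edge_le)
  tail_mem he' := by
    rw [tail_lastOut_sub_one _ he']
    exact (prefix_enqueue.take qh).subset (h.tail_mem he)
  head_mem f hf hf' := by
    rw [h.unscanned_scan he, Finset.mem_erase, not_and_or, not_ne_iff] at hf'
    obtain rfl | hf' := hf'
    exacts [mem_enqueue.2 (.inr rfl), mem_enqueue.2 (.inl (h.head_mem f hf hf'))]
  start_subset := fun _ hv => mem_enqueue.2 (.inl (h.start_subset hv))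
  reachable v hv := by
    obtain hv | rfl := mem_enqueue.1 hv
    · exact h.reachable v hv
    · obtain ⟨u, hu, hreach⟩ := h.reachable _ (List.mem_of_mem_take (h.tail_mem he))
      have := h.edge_le
      exact ⟨u, hu, hreach.tail ⟨e - 1, by omega, rfl, rfl⟩⟩

theorem mem_iff_reachable (h : E.SearchInv l₀ l l.length 0) :
    v ∈ l ↔ ∃ u ∈ l₀, Relation.ReflTransGen E.Adj u v := by
  refine ⟨h.reachable v, ?_⟩
  rintro ⟨u, hu, hreach⟩
  induction hreach with
  | refl => exact h.start_subset hu
  | tail _ hadj ih =>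
    obtain ⟨f, hf, rfl, rfl⟩ := hadj
    exact h.head_mem f hf (by simp [unscanned, ih])

end SearchInv

end EdgeSeq

/-- The integer nearest to `c * 2 ^ i / R`, where `c` is a number of hits in `R` rounds in which
items are sampled with probability `2 ^ (-i)`. -/
def scaledCount (R i c : ℕ) : ℕ := (2 * (c * 2 ^ i) + R) / (2 * R)

/-- The scaled count of the largest level `i < k` with at least `thr` hits, and `0` if there is no
such level. -/
def levelEstimate (R thr : ℕ) (c : ℕ → ℕ) : ℕ → ℕ
  | 0 => 0
  | k + 1 => if c k < thr then levelEstimate R thr c k else scaledCount R k (c k)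

theorem levelEstimate_cases (R thr : ℕ) (c : ℕ → ℕ) (k : ℕ) :
    ((∀ i < k, c i < thr) ∧ levelEstimate R thr c k = 0) ∨
    ∃ i < k, thr ≤ c i ∧ (∀ j < k, i < j → c j < thr) ∧
      levelEstimate R thr c k = scaledCount R i (c i) := by
  induction k with
  | zero => simp [levelEstimate]
  | succ k ih =>
    rw [levelEstimate]
    split_ifs with hk
    · obtain ⟨hlt, heq⟩ | ⟨i, hi, hthr, hlt, heq⟩ := ih
      · exact .inl ⟨Nat.forall_lt_succ_right.2 ⟨hlt, hk⟩, heq⟩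
      · exact .inr ⟨i, by omega, hthr, Nat.forall_lt_succ_right.2 ⟨hlt, fun _ => hk⟩, heq⟩
    · exact .inr ⟨k, by omega, not_lt.1 hk, fun j hj hkj => by omega, rfl⟩

theorem abs_scaledCount_sub_le {R : ℕ} (hR : 0 < R) (i c : ℕ) :
    |(scaledCount R i c : ℝ) - c / R * 2 ^ i| ≤ 1 / 2 := by
  have hlower : scaledCount R i c * (2 * R) ≤ 2 * (c * 2 ^ i) + R := Nat.div_mul_le_self _ _
  have hupper : 2 * (c * 2 ^ i) + R < 2 * R * (scaledCount R i c + 1) :=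
    Nat.lt_mul_div_succ _ (by omega)
  rify at hR hlower hupper
  rw [div_mul_eq_mul_div, abs_le, neg_le_sub_iff_le_add, div_le_iff₀ hR, sub_le_iff_le_add',
    div_add_div _ _ hR.ne' two_ne_zero, le_div_iff₀ (by positivity)]
  constructor <;> linarith

/-- An error `1 / 2` is harmless because the estimated number is an integer. -/
theorem isEstimate_of_abs_sub_le {ε y : ℝ} {a z : ℕ} (hz : |(z : ℝ) - y| ≤ 1 / 2)
    (hy : |y - a| ≤ ε / 4 * a) : IsEstimate ε a z := by
  obtain ⟨hz₁, hz₂⟩ := abs_le.1 hz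
  obtain ⟨hy₁, hy₂⟩ := abs_le.1 hy
  rw [IsEstimate]
  by_cases hs : ε / 4 * a < 1 / 2
  · have hza : z = a := by
      have hlt : (z : ℝ) < (a + 1 : ℕ) := by push_cast; linarith
      have hgt : (a : ℝ) < (z + 1 : ℕ) := by push_cast; linarith
      norm_cast at hlt hgt
      omega
    rw [hza]
    constructor <;> linarith
  · constructor <;> linarith

/-- The probability that at least one of `a` independent events of probability `2 ^ (-i)` occurs. -/
noncomputable def hitProb (a i : ℕ) : ℝ := 1 - (1 - 1 / 2 ^ i) ^ a

theorem one_div_two_pow_le_one (i : ℕ) : (1 : ℝ) / 2 ^ i ≤ 1 :=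
  div_le_one_of_le₀ (one_le_pow₀ one_le_two) (by positivity)

theorem hitProb_le (a i : ℕ) : hitProb a i ≤ a / 2 ^ i := by
  have hp := one_div_two_pow_le_one i
  have hbernoulli := one_add_mul_le_pow (a := -((1 : ℝ) / 2 ^ i)) (by linarith) a
  rw [← sub_eq_add_neg] at hbernoulli
  rw [hitProb, div_eq_mul_one_div (a : ℝ)]
  linarith

theorem div_mul_le_hitProb (a i : ℕ) : (a : ℝ) / 2 ^ i * (1 - hitProb a i) ≤ hitProb a i := by
  rw [hitProb, div_eq_mul_one_div]
  have hp := one_div_two_pow_le_one i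
  have hp₀ : (0 : ℝ) < 1 / 2 ^ i := by positivity
  generalize (1 : ℝ) / 2 ^ i = p at hp hp₀
  have hbernoulli := one_add_mul_le_pow (a := p) (by linarith) a
  have : (0 : ℝ) ≤ (1 - p) ^ a := pow_nonneg (by linarith) a
  have hprod : (1 - p) ^ a * (1 + a * p) ≤ 1 :=
    calc (1 - p) ^ a * (1 + a * p) ≤ (1 - p) ^ a * (1 + p) ^ a := by gcongr
      _ = ((1 - p) * (1 + p)) ^ a := (mul_pow _ _ _).symm
      _ ≤ 1 := pow_le_one₀ (by nlinarith) (by nlinarith)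
  linarith

theorem hitProb_le_two_mul (a i : ℕ) : hitProb a i ≤ 2 * hitProb a (i + 1) := by
  have hp := one_div_two_pow_le_one i
  have hhalf : (1 : ℝ) / 2 ^ i = 2 * (1 / 2 ^ (i + 1)) := by rw [pow_succ]; field_simp
  have hp₀ : (0 : ℝ) < 1 / 2 ^ (i + 1) := by positivity
  rw [hitProb, hitProb, hhalf]
  rw [hhalf] at hp
  generalize (1 : ℝ) / 2 ^ (i + 1) = p at hp hp₀
  suffices 2 * (1 - p) ^ a ≤ 1 + (1 - 2 * p) ^ a by linarith
  induction a with
  | zero => norm_num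
  | succ a ih =>
    have hle : (1 - 2 * p) ^ a ≤ 1 := pow_le_one₀ (by linarith) (by linarith)
    rw [pow_succ, pow_succ]
    nlinarith

/-- If a frequency `y` of hits is close to its mean, large compared with the error and not too close
to `1`, then hits hardly ever collide, and `y * 2 ^ i` is close to `a`. -/
theorem abs_mul_two_pow_sub_le {δ y : ℝ} {a i : ℕ} (hδ : 0 < δ) (hδ8 : δ ≤ 1 / 8) (hy : δ ≤ y)
    (hyq : |y - hitProb a i| ≤ δ ^ 2) (hq : hitProb a i ≤ 4 * δ) :
    |y * 2 ^ i - a| ≤ 6 * δ * a := by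
  have hqx := hitProb_le a i
  have hxq := div_mul_le_hitProb a i
  have ha : (a : ℝ) = a / 2 ^ i * 2 ^ i := by field_simp
  rw [ha, ← sub_mul, abs_mul, abs_of_pos (by positivity : (0 : ℝ) < 2 ^ i), ← mul_assoc]
  refine mul_le_mul_of_nonneg_right ?_ (by positivity)
  generalize (a : ℝ) / 2 ^ i = x at hqx hxq
  generalize hitProb a i = q at *
  obtain ⟨hyq₁, hyq₂⟩ := abs_le.1 hyq
  have hq₀ : δ / 2 ≤ q := by nlinarith
  have hcollide : x - q ≤ 4 * δ * x := by nlinarith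
  have herror : δ ^ 2 ≤ 2 * δ * x := by nlinarith
  exact abs_le.2 ⟨by linarith, by nlinarith⟩

/-- At the largest level with many hits, hits are still rare, because the next level is sparse. -/
theorem hitProb_le_four_mul {δ : ℝ} {a i I : ℕ} {y : ℕ → ℝ} (hδ : 0 < δ) (hδ8 : δ ≤ 1 / 8)
    (hiI : i < I) (ha : a / 2 ^ (I - 1) ≤ δ) (hy : ∀ j < I, |y j - hitProb a j| ≤ δ ^ 2)
    (hsparse : ∀ j < I, i < j → y j < δ) : hitProb a i ≤ 4 * δ := by
  by_cases hi : i + 1 < I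
  · have hclose := abs_le.1 (hy (i + 1) hi)
    have hlt := hsparse (i + 1) hi i.lt_succ_self
    have hdouble := hitProb_le_two_mul a i
    nlinarith
  · obtain rfl : i = I - 1 := by omega
    linarith [hitProb_le a (I - 1)]

theorem isEstimate_levelEstimate {ε : ℝ} {D thr I a : ℕ} {c : ℕ → ℕ} (hε : 0 < ε) (hD : 8 ≤ D)
    (hDε : 24 / ε ≤ D) (hthr : 0 < thr) (hI : 0 < I) (ha : D * a ≤ 2 ^ (I - 1))
    (hc : ∀ i < I, |(c i : ℝ) / (D * thr : ℕ) - hitProb a i| ≤ 1 / (D : ℝ) ^ 2) :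
    IsEstimate ε a (levelEstimate (D * thr) thr c I) := by
  have hD₀ : (0 : ℝ) < D := by exact_mod_cast (by omega : 0 < D)
  have hδ8 : (1 : ℝ) / D ≤ 1 / 8 := one_div_le_one_div_of_le (by norm_num) (by exact_mod_cast hD)
  have hδε : 6 * (1 / (D : ℝ)) ≤ ε / 4 := by
    rw [div_le_iff₀ hε] at hDε
    rw [mul_one_div, div_le_div_iff₀ hD₀ (by norm_num)]
    linarith
  have hlt (i : ℕ) : (c i : ℝ) / (D * thr : ℕ) < 1 / D ↔ c i < thr := by
    have : (0 : ℝ) < thr := by exact_mod_cast hthr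
    rw [Nat.cast_mul, div_lt_div_iff₀ (by positivity) hD₀, one_mul, mul_comm,
      mul_lt_mul_iff_right₀ hD₀, Nat.cast_lt]
  simp only [← one_div_pow] at hc
  obtain ⟨hsparse, heq⟩ | ⟨i, hi, hmany, hsparse, heq⟩ := levelEstimate_cases (D * thr) thr c I
  · have hprob : hitProb a 0 < 1 := by
      have hclose := abs_le.1 (hc 0 hI)
      have hfew := (hlt 0).2 (hsparse 0 hI)
      have hδ₀ : (0 : ℝ) < 1 / D := by positivity
      nlinarith
    obtain rfl : a = 0 := by
      by_contra ha₀
      simp [hitProb, ha₀] at hprob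
    simp [heq, IsEstimate]
  · rw [heq]
    refine isEstimate_of_abs_sub_le (abs_scaledCount_sub_le (by positivity) i (c i))
      ((abs_mul_two_pow_sub_le (by positivity) hδ8 (not_lt.1 fun h => ?_) (hc i hi) ?_).trans
        (mul_le_mul_of_nonneg_right hδε a.cast_nonneg))
    · exact absurd ((hlt i).1 h) (not_lt.2 hmany)
    · refine hitProb_le_four_mul (by positivity) hδ8 hi ?_ hc fun j hj hij =>
        (hlt j).2 (hsparse j hj hij)
      rw [div_le_div_iff₀ (by positivity) hD₀, mul_comm]
      exact_mod_cast by linarith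

namespace WordRAM

/-- The tail of an edge of the input. -/
def Expr.tail (e : Expr) : Expr := .arr .input (3 + 2 * e)

/-- The head of an edge of the input. -/
def Expr.head (e : Expr) : Expr := .arr .input (4 + 2 * e)

/-- Nonzero as long as a search has an edge to follow or a vertex to remove from the queue. -/
def Expr.unfinished : Expr :=
  .bin .lor (.var .edge) (.bin .lt (.var .queueHead) (.var .queueLen))

/-- The register that holds the number of items of a kind. -/
def ItemKind.countVar : ItemKind → Var
  | .vertex => .vertexCount
  | .edge => .edgeCount

/-- The owner of item `pos`, that is, the vertex itself or the head of the edge. -/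
def ItemKind.ownerExpr : ItemKind → Expr
  | .vertex => .var .pos
  | .edge => .head (.var .pos)

namespace Prog

/-- Read the header of the input and compute the binary length of its first entry. -/
def readHeader : Prog :=
  .set .vertexCount (.load (.const 1)) ;; .set .edgeCount (.load (.const 2)) ;;
  .set .word (.load (.const 0)) ;; .set .size 0 ;;
  .loop (.var .word) (.set .word (.var .word / 2) ;; .set .size (.var .size + 1))

/-- Set the parameters of the algorithm, which are proportional to the binary length of `n`. -/
def setParameters (a b c : ℕ) : Prog :=
  .set .stride (.bin .shl 1 (3 * .var .size)) ;; .set .reps (.const a * .var .size) ;;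
  .set .levels (.const b * .var .size) ;; .set .threshold (.const c * .var .size)

/-- Read the input and compute everything that the algorithm needs to know about it. -/
def prepare (a b c : ℕ) : Prog := .readHeader ;; .setParameters a b c

/-- Link the edges with a common tail. Edge `e` is represented by `e + 1`, the end of a list by
`0`. -/
def buildLists : Prog :=
  .count .pos .edgeCount
    (.put .next (.var .pos) (.arr .first (.tail (.var .pos))) ;;
      .put .first (.tail (.var .pos)) (.var .pos + 1))

/-- Mark and enqueue a vertex unless it has been marked before. -/
def visit : Prog :=
  .cond (.arr .mark (.var .vertex)) .skip
    (.put .mark (.var .vertex) 1 ;; .put .queue (.var .queueLen) (.var .vertex) ;;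
      .set .queueLen (.var .queueLen + 1))

/-- Visit the owner of item `pos` with probability `1 / scale`. -/
def sampleItem (k : ItemKind) : Prog :=
  .set .vertex k.ownerExpr ;; .draw .word ;; .cond (.var .word % .var .scale) .skip .visit

/-- Start a queue with the owners of a random sample of the items. -/
def sampleItems (k : ItemKind) : Prog :=
  .set .queueLen 0 ;; .count .pos k.countVar (.sampleItem k)

/-- Visit the head of the edge that is represented by register `edge` and step to its successor in
its adjacency list. -/
def followEdge : Prog :=
  .set .vertex (.head (.var .edge - 1)) ;; .set .edge (.arr .next (.var .edge - 1)) ;; .visit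

/-- Remove a vertex from the queue and turn to its adjacency list. -/
def dequeue : Prog :=
  .set .edge (.arr .first (.arr .queue (.var .queueHead))) ;;
  .set .queueHead (.var .queueHead + 1)

/-- Mark and enqueue everything that is reachable from the vertices in the queue. -/
def search : Prog :=
  .set .queueHead 0 ;; .set .edge 0 ;;
  .loop .unfinished (.cond (.var .edge) .followEdge .dequeue)

/-- Add the marks to the numbers of hits and erase them. -/
def tally : Prog :=
  .count .pos .vertexCount
    (.put .hits (.var .pos) (.arr .hits (.var .pos) + .arr .mark (.var .pos)) ;;
      .put .mark (.var .pos) 0)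

/-- Replace the estimate of vertex `pos` if it has many hits, and reset its number of hits. -/
def concludeVertex (k : ItemKind) : Prog :=
  .cond (.bin .lt (.arr .hits (.var .pos)) (.var .threshold)) .skip
    (.put (.estimate k) (.var .pos)
      ((2 * (.arr .hits (.var .pos) * .var .scale) + .var .reps) / (2 * .var .reps))) ;;
  .put .hits (.var .pos) 0

/-- Conclude a level of sampling probabilities. -/
def conclude (k : ItemKind) : Prog := .count .pos .vertexCount (.concludeVertex k)

/-- Count the hits in independent rounds with a fixed sampling probability. -/
def countHits (k : ItemKind) : Prog :=
  .count .rep .reps (.sampleItems k ;; .search ;; .tally)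

/-- Count the hits at level `level`, where items are sampled with probability `2 ^ (-level)`, and
update the estimates. -/
def runLevel (k : ItemKind) : Prog :=
  .set .scale (.bin .shl 1 (.var .level)) ;; .countHits k ;; .conclude k

/-- Estimate, for each vertex, the number of items whose owner reaches it. -/
def estimate (k : ItemKind) : Prog := .count .level .levels (.runLevel k)

/-- Store the addresses of the estimates in the output registers. -/
def writeOutput : Prog :=
  .set (.output .vertex) (.adr (.estimate .vertex) 0) ;;
  .set (.output .edge) (.adr (.estimate .edge) 0)

/-- The algorithm, with parameters that depend on `ε` and `d` only. -/
def algorithm (a b c : ℕ) : Prog :=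
  .prepare a b c ;; .buildLists ;; .estimate .vertex ;; .estimate .edge ;; .writeOutput

end Prog

end WordRAM

namespace WordRAM

variable {w S N : ℕ} {ω : ℕ → Fin (2 ^ w)} {E : EdgeSeq} {s t : State} {l l₀ : List ℕ}

/-- The machine stores, as its input, a graph with the vertices `0, …, N - 1` and the edges `E`. -/
structure HasGraph (w S N : ℕ) (E : EdgeSeq) (s : State) : Prop extends Layout w S s where
  vertices_le : N ≤ S
  edges_le : 2 * E.size + 3 ≤ S
  tail_lt : ∀ f < E.size, E.tail f < N
  head_lt : ∀ f < E.size, E.head f < N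
  vertexCount : s.var .vertexCount = N
  edgeCount : s.var .edgeCount = E.size
  arr_tail : ∀ f < E.size, s.arr S .input (3 + 2 * f) = E.tail f
  arr_head : ∀ f < E.size, s.arr S .input (4 + 2 * f) = E.head f

namespace HasGraph

variable {e : Expr} {f : ℕ}

theorem of_frame {vs : List Var} {as : List Arr} {k : ℕ} (h : HasGraph w S N E s)
    (hf : Frame S vs as k s t)
    (hvs : ∀ v ∈ [Var.stride, .vertexCount, .edgeCount], v ∉ vs := by simp)
    (has : Arr.input ∉ as := by simp) : HasGraph w S N E t where
  toLayout := h.toLayout.of_frame hf (hvs _ (by simp))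
  vertices_le := h.vertices_le
  edges_le := h.edges_le
  tail_lt := h.tail_lt
  head_lt := h.head_lt
  vertexCount := (hf.var _ (hvs _ (by simp))).trans h.vertexCount
  edgeCount := (hf.var _ (hvs _ (by simp))).trans h.edgeCount
  arr_tail f hfE := by
    have := h.edges_le
    rw [hf.arr _ (by omega) has, h.arr_tail f hfE]
  arr_head f hfE := by
    have := h.edges_le
    rw [hf.arr _ (by omega) has, h.arr_head f hfE]

theorem value_tail (h : HasGraph w S N E s) (he : e.value w s = f) (hf : f < E.size) :
    (Expr.tail e).value w s = E.tail f := by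
  have hedges := h.edges_le
  have hfits := h.fits
  rw [Expr.tail, h.value_arr .input (Expr.value_add (Expr.value_ofNat (k := 3) (by omega))
    (Expr.value_mul (Expr.value_ofNat (k := 2) (by omega)) he (by omega)) (by omega)) (by omega),
    h.arr_tail f hf]

theorem value_head (h : HasGraph w S N E s) (he : e.value w s = f) (hf : f < E.size) :
    (Expr.head e).value w s = E.head f := by
  have hedges := h.edges_le
  have hfits := h.fits
  rw [Expr.head, h.value_arr .input (Expr.value_add (Expr.value_ofNat (k := 4) (by omega))
    (Expr.value_mul (Expr.value_ofNat (k := 2) (by omega)) he (by omega)) (by omega)) (by omega),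
    h.arr_head f hf]

end HasGraph

/-- The machine stores a graph together with its adjacency lists. -/
structure HasLists (w S N : ℕ) (E : EdgeSeq) (s : State) : Prop extends HasGraph w S N E s where
  arr_first : ∀ u < N, s.arr S .first u = E.lastOut u E.size
  arr_next : ∀ f < E.size, s.arr S .next f = E.lastOut (E.tail f) f

theorem HasLists.of_frame {vs : List Var} {as : List Arr} {k : ℕ} (h : HasLists w S N E s)
    (hf : Frame S vs as k s t)
    (hvs : ∀ v ∈ [Var.stride, .vertexCount, .edgeCount], v ∉ vs := by simp)
    (has : ∀ a ∈ [Arr.input, .first, .next], a ∉ as := by simp) : HasLists w S N E t where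
  toHasGraph := h.toHasGraph.of_frame hf hvs (has _ (by simp))
  arr_first u hu := by
    rw [hf.arr _ (hu.trans_le h.vertices_le) (has _ (by simp)), h.arr_first u hu]
  arr_next f hfE := by
    have := h.edges_le
    rw [hf.arr _ (by omega) (has _ (by simp)), h.arr_next f hfE]

theorem run_buildLists (hs : HasGraph w S N E s) (hfirst : ∀ u < N, s.arr S .first u = 0) :
    Run w ω .buildLists s (E.size * 60 + 6) fun t =>
      Frame S [.pos] [.first, .next] 0 s t ∧ HasLists w S N E t := by
  have hedges := hs.edges_le
  have hvertices := hs.vertices_le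
  have hfits := hs.fits
  refine (Run.count (B := 52) (fun k t => Frame S [.pos] [.first, .next] 0 s t ∧
    (∀ u < N, t.arr S .first u = E.lastOut u k) ∧
    ∀ f < k, t.arr S .next f = E.lastOut (E.tail f) f) (by decide) (by omega) hs.edgeCount
    ⟨(Frame.refl ..).set _ _, hfirst, by simp⟩ ?_).mono le_rfl ?_
  · rintro k hk t ⟨hframe, hfirst, hnext⟩ hpos
    have ht := hs.of_frame hframe
    have htail := hs.tail_lt k hk
    have hframe' := hframe.put (y := E.lastOut (E.tail k) k) .next (by omega : k < S)
    have ht' := hs.of_frame hframe'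
    have hnew : (Expr.arr .first (.tail (.var .pos))).value w t = E.lastOut (E.tail k) k := by
      rw [ht.value_arr .first (ht.value_tail (Expr.value_var hpos) hk) (by omega), hfirst _ htail]
    refine Run.of_wp (wp_seq <| wp_put ht.toLayout hpos (by omega) hnew
      (wp_put ht'.toLayout (ht'.value_tail hpos hk) (by omega)
      (Expr.value_add hpos (Expr.value_ofNat (k := 1) (by omega)) (by omega))
      ⟨hpos, rfl, (hframe'.put .first (by omega)).set .pos _, fun u hu => ?_, fun f hf => ?_⟩))
      (by decide)
    · rw [State.arr_set, State.arr_put (by omega) (by omega), State.arr_put (by omega) (by omega),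
        EdgeSeq.lastOut, hfirst u hu]
      simp [eq_comm]
    · rw [State.arr_set, State.arr_put (by omega) (by omega), State.arr_put (by omega) (by omega)]
      obtain rfl | hfk := Nat.lt_succ_iff_lt_or_eq.1 hf |>.symm
      · simp
      · simp [hnext f hfk, hfk.ne]
  · rintro t ⟨hframe, hfirst, hnext⟩
    exact ⟨hframe, hs.of_frame hframe, hfirst, hnext⟩

/-- The entries of `l` are the marked vertices, and the machine stores `l` as its queue. -/
structure Queued (S N : ℕ) (l : List ℕ) (s : State) : Prop where
  nodup : l.Nodup
  lt : ∀ v ∈ l, v < N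
  queueLen : s.var .queueLen = l.length
  arr_queue : ∀ p (hp : p < l.length), s.arr S .queue p = l[p]
  arr_mark : ∀ v < N, s.arr S .mark v = if v ∈ l then 1 else 0

theorem length_le_of_nodup (h : l.Nodup) (hlt : ∀ v ∈ l, v < N) : l.length ≤ N :=
  (h.subperm fun v hv => List.mem_range.2 (hlt v hv)).length_le.trans_eq List.length_range

theorem Queued.of_frame {vs : List Var} {as : List Arr} {k : ℕ} (h : Queued S N l s) (hN : N ≤ S)
    (hf : Frame S vs as k s t) (hvs : .queueLen ∉ vs := by simp)
    (has : ∀ a ∈ [Arr.queue, .mark], a ∉ as := by simp) : Queued S N l t where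
  nodup := h.nodup
  lt := h.lt
  queueLen := (hf.var _ hvs).trans h.queueLen
  arr_queue p hp := by
    have := length_le_of_nodup h.nodup h.lt
    rw [hf.arr _ (by omega) (has _ (by simp)), h.arr_queue p hp]
  arr_mark v hv := by rw [hf.arr _ (by omega) (has _ (by simp)), h.arr_mark v hv]

theorem wp_visit {v : ℕ} {Q : State → Prop} (hs : Layout w S s) (hN : N ≤ S)
    (hl : Queued S N l s) (hvar : s.var .vertex = v) (hv : v < N)
    (hQ : ∀ t, Frame S [.queueLen] [.mark, .queue] 0 s t →
      Queued S N (EdgeSeq.enqueue l v) t → Q t) :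
    Prog.visit.wp w ω Q s := by
  have hfits := hs.fits
  have hmark : (Expr.arr .mark (.var .vertex)).value w s = if v ∈ l then 1 else 0 := by
    rw [hs.value_arr .mark (Expr.value_var hvar) (by omega), hl.arr_mark v hv]
  refine ⟨fun hne => ?_, fun heq => ?_⟩
  · have hvl : v ∈ l := by simpa [hmark] using hne
    exact hQ s (Frame.refl ..) (by rwa [EdgeSeq.enqueue, if_pos hvl])
  have hvl : v ∉ l := by simpa [hmark] using heq
  have hnodup : (l ++ [v]).Nodup := List.concat_eq_append ▸ hl.nodup.concat hvl
  have hlt : ∀ u ∈ l ++ [v], u < N := by simpa [or_imp, forall_and, hv] using hl.lt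
  have hlen : l.length < N := by simpa using length_le_of_nodup hnodup hlt
  have hframe := (Frame.refl S [.queueLen] [.mark, .queue] s).put (y := 1) .mark
    (by omega : v < S)
  refine wp_seq <| wp_put hs hvar (by omega) (Expr.value_ofNat (k := 1) (by omega))
    (wp_seq <| wp_put (hs.of_frame hframe) hl.queueLen (by omega) hvar
    (wp_set (Expr.value_add hl.queueLen (Expr.value_ofNat (k := 1) (by omega)) (by omega))
    (hQ _ ((hframe.put .queue (by omega)).set .queueLen _) ?_)))
  rw [EdgeSeq.enqueue, if_neg hvl]
  refine ⟨hnodup, hlt, by simp, fun p hp => ?_, fun u hu => ?_⟩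
  · rw [List.length_append, List.length_singleton] at hp
    rw [State.arr_set, State.arr_put (by omega) (by omega), State.arr_put (by omega) (by omega)]
    obtain rfl | hpl := Nat.lt_succ_iff_lt_or_eq.1 hp |>.symm
    · simp
    · simp [hpl.ne, hl.arr_queue p hpl, List.getElem_append_left hpl]
  · rw [State.arr_set, State.arr_put (by omega) (by omega), State.arr_put (by omega) (by omega),
      hl.arr_mark u hu]
    by_cases huv : u = v <;> simp [huv]

end WordRAM

namespace WordRAM

variable {w S N i j : ℕ} {ω : ℕ → Fin (2 ^ w)} {E : EdgeSeq} {s t : State} {k : ItemKind}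
  {l l₀ : List ℕ}

namespace ItemKind

/-- The number of items of a kind in a graph with `N` vertices and the edges `E`. -/
def count (N : ℕ) (E : EdgeSeq) : ItemKind → ℕ
  | .vertex => N
  | .edge => E.size

/-- A vertex owns itself and an edge is owned by its head, so that the items owned by the ancestors
of a vertex are its ancestors and the edges between them. -/
def owner (E : EdgeSeq) : ItemKind → ℕ → ℕ
  | .vertex => id
  | .edge => E.head

end ItemKind

namespace HasGraph

theorem count_le (hs : HasGraph w S N E s) (k : ItemKind) : k.count N E ≤ S := by
  have := hs.edges_le
  cases k
  exacts [hs.vertices_le, show E.size ≤ S by omega]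

theorem var_countVar (hs : HasGraph w S N E s) (k : ItemKind) : s.var k.countVar = k.count N E := by
  cases k
  exacts [hs.vertexCount, hs.edgeCount]

theorem owner_lt (hs : HasGraph w S N E s) (hj : j < k.count N E) : k.owner E j < N := by
  cases k
  exacts [hj, hs.head_lt j hj]

theorem value_ownerExpr (hs : HasGraph w S N E s) (hpos : s.var .pos = j) (hj : j < k.count N E) :
    k.ownerExpr.value w s = k.owner E j := by
  cases k
  exacts [hpos, hs.value_head (Expr.value_var hpos) hj]

end HasGraph

theorem queued_nil (hqueueLen : s.var .queueLen = 0) (hmark : ∀ v < N, s.arr S .mark v = 0) :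
    Queued S N [] s where
  nodup := .nil
  lt := by simp
  queueLen := hqueueLen
  arr_queue := by simp
  arr_mark := by simpa using hmark

theorem wp_sampleItem {Q : State → Prop} (hs : HasGraph w S N E s) (hl : Queued S N l s)
    (hscale : s.var .scale = 2 ^ i) (hpos : s.var .pos = j) (hj : j < k.count N E)
    (hQ : ∀ t l', Frame S [.queueLen, .vertex, .word] [.mark, .queue] 1 s t → Queued S N l' t →
      (∀ v, v ∈ l' ↔ v ∈ l ∨ k.owner E j = v ∧ 2 ^ i ∣ (ω s.drawn : ℕ)) → Q t) :
    (Prog.sampleItem k).wp w ω Q s := by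
  have hframe := ((Frame.refl S [.queueLen, .vertex, .word] [.mark, .queue] s).set
    .vertex (k.owner E j)).draw .word (ω s.drawn)
  have hlayout := hs.toLayout.of_frame hframe
  have hl' : Queued S N l ((s.set .vertex (k.owner E j)).draw .word (ω s.drawn)) :=
    ⟨hl.nodup, hl.lt, by simpa using hl.queueLen, hl.arr_queue, hl.arr_mark⟩
  refine wp_seq <| wp_set (hs.value_ownerExpr hpos hj) <| wp_seq <| wp_draw ?_
  have hvalue : (Expr.var .word % Expr.var .scale).value w
      ((s.set .vertex (k.owner E j)).draw .word (ω s.drawn)) = (ω s.drawn : ℕ) % 2 ^ i :=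
    Expr.value_mod (Expr.value_var (by simp)) (Expr.value_var (by simpa using hscale))
  refine ⟨fun hne => hQ _ l hframe hl' fun v => ?_, fun heq => ?_⟩
  · have hndvd : ¬2 ^ i ∣ (ω s.drawn : ℕ) := fun h => hne (hvalue.trans (Nat.mod_eq_zero_of_dvd h))
    simp [hndvd]
  · have hdvd : 2 ^ i ∣ (ω s.drawn : ℕ) := Nat.dvd_of_mod_eq_zero (hvalue.symm.trans heq)
    refine wp_visit hlayout hs.vertices_le hl' (by simp) (hs.owner_lt hj) fun t ht hlt =>
      hQ t _ (hframe.trans ht.mono) hlt fun v => ?_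
    simp [EdgeSeq.mem_enqueue, hdvd, eq_comm]

theorem run_sampleItems (hs : HasGraph w S N E s) (hmark : ∀ v < N, s.arr S .mark v = 0)
    (hscale : s.var .scale = 2 ^ i) :
    Run w ω (.sampleItems k) s (k.count N E * 80 + 8) fun t =>
      Frame S [.queueLen, .pos, .vertex, .word] [.mark, .queue] (k.count N E) s t ∧
      ∃ l, Queued S N l t ∧
        ∀ v, v ∈ l ↔ ∃ j < k.count N E, k.owner E j = v ∧ 2 ^ i ∣ (ω (s.drawn + j) : ℕ) := by
  have hcount := hs.count_le k
  have hedges := hs.edges_le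
  have hfits := hs.fits
  let Inv (j : ℕ) (t : State) : Prop :=
    Frame S [.queueLen, .pos, .vertex, .word] [.mark, .queue] j s t ∧
    ∃ l, Queued S N l t ∧ ∀ v, v ∈ l ↔ ∃ j' < j, k.owner E j' = v ∧ 2 ^ i ∣ (ω (s.drawn + j') : ℕ)
  have hframe₀ := (Frame.refl S [.queueLen, .pos, .vertex, .word] [.mark, .queue] s).set .queueLen 0
  refine (Run.of_wp_seq (B := k.count N E * 80 + 6) (Q := Inv (k.count N E))
    (wp_set (Expr.value_ofNat (by positivity)) ?_)).mono (by
      simp only [Prog.set, Prog.time, Expr.cost]; omega)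
    fun _ => id
  refine (Run.count (B := 72) Inv (by cases k <;> decide) (by omega)
    ((hs.of_frame hframe₀).var_countVar k)
    ⟨hframe₀.set .pos 0, [], queued_nil (by simp) hmark, by simp⟩ ?_)
  rintro j hj t ⟨hframe, l, hl, hmem⟩ hpos
  have ht := hs.of_frame hframe
  refine Run.of_wp (wp_sampleItem ht hl ((hframe.var .scale).trans hscale) hpos hj
    fun u l' hframe' hl' hmem' => ⟨(hframe'.var .pos).trans hpos, ?_,
      (hframe.trans hframe'.mono).set .pos _, l',
      hl'.of_frame hs.vertices_le ((Frame.refl S [.pos] [] u).set .pos _), fun v => ?_⟩)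
    (by cases k <;> decide)
  · rw [ht.var_countVar, (ht.of_frame hframe').var_countVar]
  · rw [hmem', hmem, Nat.exists_lt_succ_right, hframe.drawn]

/-- The state of a graph search from the vertices of `l₀`: the machine stores the queue `l`, of
which the first `qh` vertices have been removed, and the next link `e` of the adjacency list that is
being scanned. -/
structure Searching (S N : ℕ) (E : EdgeSeq) (l₀ l : List ℕ) (qh e : ℕ) (s : State) : Prop
    extends Queued S N l s where
  inv : E.SearchInv l₀ l qh e
  queueHead : s.var .queueHead = qh
  edge : s.var .edge = e

variable {qh e : ℕ}

theorem Searching.value_unfinished_ne_zero (h : Searching S N E l₀ l qh e s) :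
    Expr.unfinished.value w s ≠ 0 ↔ e ≠ 0 ∨ qh < l.length := by
  rw [Expr.unfinished, Expr.value_lor_ne_zero, Expr.value_lt_ne_zero, Expr.value_var h.edge,
    Expr.value_var h.queueHead, Expr.value_var h.queueLen]

theorem wp_followEdge {Q : State → Prop} (hs : HasLists w S N E s)
    (hsearch : Searching S N E l₀ l qh e s) (he : e ≠ 0)
    (hQ : ∀ t, Frame S [.edge, .vertex, .queueLen] [.mark, .queue] 0 s t →
      Searching S N E l₀ (EdgeSeq.enqueue l (E.head (e - 1))) qh
        (E.lastOut (E.tail (e - 1)) (e - 1)) t → Q t) :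
    Prog.followEdge.wp w ω Q s := by
  have hedges := hs.edges_le
  have hfits := hs.fits
  have heE : e - 1 < E.size := by have := hsearch.inv.edge_le; omega
  have hprev (x : ℕ) : (Expr.var .edge - 1).value w (s.set .vertex x) = e - 1 := by
    have hedge : (s.set .vertex x).var .edge = e := by simpa using hsearch.edge
    exact Expr.value_sub (Expr.value_var hedge) (Expr.value_ofNat (k := 1) (by omega)) (by omega)
      (by omega)
  have hframe := (Frame.refl S [.edge, .vertex, .queueLen] [.mark, .queue] s).set .vertex
    (E.head (e - 1))
  have hframe' := hframe.set .edge (E.lastOut (E.tail (e - 1)) (e - 1))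
  have hedge : (Expr.var .edge).value w s = e := hsearch.edge
  refine wp_seq <| wp_set (hs.value_head (Expr.value_sub (Expr.value_var hsearch.edge)
    (Expr.value_ofNat (k := 1) (by omega)) (by omega) (by omega)) heE) <| wp_seq <|
    wp_set (((hs.toLayout.of_frame hframe).value_arr .next (hprev _) (by omega)).trans
      (hs.arr_next _ heE)) <|
    wp_visit (hs.toLayout.of_frame hframe') hs.vertices_le (l := l)
      ⟨hsearch.nodup, hsearch.lt, by simpa using hsearch.queueLen, hsearch.arr_queue,
        hsearch.arr_mark⟩ (by simp) (hs.head_lt _ heE)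
      fun t ht hl => hQ t (hframe'.trans ht.mono) ⟨hl, hsearch.inv.scan he, ?_, ?_⟩
  · rw [ht.var .queueHead]
    simpa using hsearch.queueHead
  · rw [ht.var .edge]
    simp

theorem wp_dequeue {Q : State → Prop} (hs : HasLists w S N E s)
    (hsearch : Searching S N E l₀ l qh 0 s) (hqh : qh < l.length)
    (hQ : ∀ t, Frame S [.edge, .queueHead] [] 0 s t →
      Searching S N E l₀ l (qh + 1) (E.lastOut l[qh] E.size) t → Q t) :
    Prog.dequeue.wp w ω Q s := by
  have hlength := length_le_of_nodup hsearch.nodup hsearch.lt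
  have hN := hs.vertices_le
  have hfits := hs.fits
  have hlt := hsearch.lt _ (List.getElem_mem hqh)
  have hfront : (Expr.arr .queue (.var .queueHead)).value w s = l[qh] := by
    rw [hs.value_arr .queue (Expr.value_var hsearch.queueHead) (by omega), hsearch.arr_queue _ hqh]
  have hlink : (Expr.arr .first (.arr .queue (.var .queueHead))).value w s =
      E.lastOut l[qh] E.size := by
    rw [hs.value_arr .first hfront (by omega), hs.arr_first _ hlt]
  have hhead : (s.set .edge (E.lastOut l[qh] E.size)).var .queueHead = qh := by
    simpa using hsearch.queueHead
  have hframe := ((Frame.refl S [.edge, .queueHead] [] s).set .edge (E.lastOut l[qh] E.size)).set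
    .queueHead (qh + 1)
  exact wp_seq <| wp_set hlink <| wp_set (Expr.value_add (Expr.value_var hhead)
    (Expr.value_ofNat (k := 1) (by omega)) (by omega)) <|
    hQ _ hframe ⟨hsearch.of_frame hN hframe, hsearch.inv.remove hqh, by simp, by simp⟩

theorem wp_searchStep {Q : State → Prop} (hs : HasLists w S N E s)
    (hsearch : Searching S N E l₀ l qh e s) (hbusy : e ≠ 0 ∨ qh < l.length)
    (hQ : ∀ t l' qh' e', Frame S [.edge, .queueHead, .vertex, .queueLen] [.mark, .queue] 0 s t →
      Searching S N E l₀ l' qh' e' t →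
      N - qh' + (E.unscanned l' qh' e').card < N - qh + (E.unscanned l qh e).card → Q t) :
    (Prog.cond (.var .edge) .followEdge .dequeue).wp w ω Q s := by
  have hedge : (Expr.var .edge).value w s = e := hsearch.edge
  refine ⟨fun hne => ?_, fun heq => ?_⟩
  · have he : e ≠ 0 := hedge ▸ hne
    refine wp_followEdge hs hsearch he fun t ht hsearch' => hQ t _ _ _ ht.mono hsearch' ?_
    have hcard := Finset.card_erase_lt_of_mem (hsearch.inv.mem_unscanned he)
    rw [hsearch.inv.unscanned_scan he]
    omega
  · obtain rfl : e = 0 := hedge ▸ heq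
    have hqh : qh < l.length := hbusy.resolve_left (by simp)
    refine wp_dequeue hs hsearch hqh fun t ht hsearch' => hQ t _ _ _ ht.mono hsearch' ?_
    have hlength := length_le_of_nodup hsearch.nodup hsearch.lt
    rw [hsearch.inv.unscanned_remove hqh]
    omega

theorem run_search (hs : HasLists w S N E s) (hl₀ : Queued S N l₀ s) :
    Run w ω .search s ((N + E.size) * 60 + 20) fun t =>
      Frame S [.edge, .queueHead, .vertex, .queueLen] [.mark, .queue] 0 s t ∧
      ∃ l, Queued S N l t ∧ ∀ v, v ∈ l ↔ ∃ u ∈ l₀, Relation.ReflTransGen E.Adj u v := by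
  let Inv (κ : ℕ) (t : State) : Prop :=
    Frame S [.edge, .queueHead, .vertex, .queueLen] [.mark, .queue] 0 s t ∧
    ∃ l qh e, Searching S N E l₀ l qh e t ∧ κ = N - qh + (E.unscanned l qh e).card
  have hunscanned : (E.unscanned l₀ 0 0).card ≤ E.size :=
    (Finset.card_filter_le _ _).trans_eq (Finset.card_range _)
  have hframe := ((Frame.refl S [.queueHead, .edge] [] s).set .queueHead 0).set .edge 0
  have hloop := Run.loop (ω := ω) (B := 53) (b := .unfinished)
    (p := .cond (.var .edge) .followEdge .dequeue)
    (Q := fun t => Frame S [.edge, .queueHead, .vertex, .queueLen] [.mark, .queue] 0 s t ∧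
      ∃ l, Queued S N l t ∧ ∀ v, v ∈ l ↔ ∃ u ∈ l₀, Relation.ReflTransGen E.Adj u v) Inv
    ⟨hframe.mono, l₀, 0, 0,
      ⟨hl₀.of_frame hs.vertices_le hframe, .start hl₀.nodup, by simp, by simp⟩, rfl⟩ ?_ ?_
  · refine (Run.of_wp_seq <| wp_set (Expr.value_ofNat (by positivity)) <| Run.of_wp_seq <|
      wp_set (Expr.value_ofNat (by positivity)) hloop).mono ?_ fun _ => id
    have hcost : Expr.unfinished.cost = 5 := rfl
    simp only [Prog.set, Prog.time, Expr.cost, hcost]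
    omega
  · rintro _ t ⟨hframe, l, qh, e, hsearch, rfl⟩ hne
    exact Run.of_wp (wp_searchStep (hs.of_frame hframe) hsearch
      (hsearch.value_unfinished_ne_zero.1 hne)
      fun u l' qh' e' hframe' hsearch' hlt => ⟨_, hlt, hframe.trans hframe', l', qh', e', hsearch',
        rfl⟩) (by decide)
  · rintro _ t ⟨hframe, l, qh, e, hsearch, rfl⟩ heq
    obtain ⟨he, hqh⟩ := not_or.1 (mt hsearch.value_unfinished_ne_zero.2 (not_not.2 heq))
    obtain rfl : e = 0 := not_not.1 he
    obtain rfl : qh = l.length := le_antisymm hsearch.inv.removed_le (not_lt.1 hqh)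
    exact ⟨hframe, l, hsearch.toQueued, fun v => hsearch.inv.mem_iff_reachable⟩

end WordRAM

namespace WordRAM

variable {w S N i J R thr I : ℕ} {ω : ℕ → Fin (2 ^ w)} {E : EdgeSeq} {s t : State} {k : ItemKind}
  {h : ℕ → ℕ}

/-- Between two rounds the machine stores a graph with its adjacency lists and the numbers `h` of
hits of the vertices, and no vertex is marked. -/
structure HasHits (w S N : ℕ) (E : EdgeSeq) (h : ℕ → ℕ) (s : State) : Prop
    extends HasLists w S N E s where
  arr_mark : ∀ v < N, s.arr S .mark v = 0
  arr_hits : ∀ v < N, s.arr S .hits v = h v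

theorem HasHits.of_frame {vs : List Var} {as : List Arr} {j : ℕ} (hs : HasHits w S N E h s)
    (hf : Frame S vs as j s t)
    (hvs : ∀ v ∈ [Var.stride, .vertexCount, .edgeCount], v ∉ vs := by simp)
    (has : ∀ a ∈ [Arr.input, .first, .next, .mark, .hits], a ∉ as := by simp) :
    HasHits w S N E h t where
  toHasLists := hs.toHasLists.of_frame hf hvs fun a ha => has a (by simp at ha ⊢; tauto)
  arr_mark v hv := by rw [hf.arr _ (hv.trans_le hs.vertices_le) (has _ (by simp)), hs.arr_mark v hv]
  arr_hits v hv := by rw [hf.arr _ (hv.trans_le hs.vertices_le) (has _ (by simp)), hs.arr_hits v hv]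

theorem run_tally (hs : HasGraph w S N E s)
    (hfits : ∀ v < N, s.arr S .hits v + s.arr S .mark v < 2 ^ w) :
    Run w ω .tally s (N * 60 + 6) fun t => Frame S [.pos] [.hits, .mark] 0 s t ∧
      ∀ v < N, t.arr S .hits v = s.arr S .hits v + s.arr S .mark v ∧ t.arr S .mark v = 0 := by
  have hvertices := hs.vertices_le
  have hedges := hs.edges_le
  have hS := hs.fits
  refine (Run.count (B := 52) (fun k t => Frame S [.pos] [.hits, .mark] 0 s t ∧
    ∀ v < N, t.arr S .hits v = s.arr S .hits v + (if v < k then s.arr S .mark v else 0) ∧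
      t.arr S .mark v = if v < k then 0 else s.arr S .mark v) (by decide) (by omega) hs.vertexCount
    ⟨(Frame.refl ..).set _ _, by simp⟩ ?_).mono le_rfl ?_
  · rintro k hk t ⟨hframe, harr⟩ hpos
    have ht := hs.of_frame hframe
    have hkS : k < S := by omega
    have hframe' := hframe.put (y := s.arr S .hits k + s.arr S .mark k) .hits hkS
    obtain ⟨hhits, hmark⟩ := harr k hk
    rw [if_neg (lt_irrefl k)] at hhits hmark
    refine Run.of_wp (wp_seq <| wp_put ht.toLayout hpos hkS (Expr.value_add
      ((ht.value_arr .hits (Expr.value_var hpos) hkS).trans hhits)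
      ((ht.value_arr .mark (Expr.value_var hpos) hkS).trans hmark)
      (hfits k hk)) <| wp_put (hs.of_frame hframe').toLayout hpos hkS
      (Expr.value_ofNat (k := 0) (by omega)) ⟨hpos, rfl, (hframe'.put .mark hkS).set .pos _,
        fun v hv => ?_⟩) (by decide)
    have hvS : v < S := by omega
    rw [State.arr_set, State.arr_put hkS hvS, State.arr_put hkS hvS, State.arr_put hkS hvS,
      State.arr_put hkS hvS, (harr v hv).1, (harr v hv).2]
    obtain hlt | rfl | hgt := lt_trichotomy v k
    · simp [hlt, hlt.ne, Nat.lt_succ_of_lt hlt]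
    · simp
    · simp [hgt.ne', not_lt.2 hgt.le, not_lt.2 (Nat.succ_le_of_lt hgt)]
  · rintro t ⟨hframe, harr⟩
    exact ⟨hframe, fun v hv => by simpa [hv] using harr v hv⟩

open Classical in
/-- The items whose owner reaches the vertex `v`. -/
noncomputable def itemsReaching (N : ℕ) (E : EdgeSeq) (k : ItemKind) (v : ℕ) : Finset ℕ :=
  {j ∈ Finset.range (k.count N E) | Relation.ReflTransGen E.Adj (k.owner E j) v}

/-- The number of rounds `r < R` in which an item of `A` is sampled at level `i`. Round `r` uses the
random words from `start + r * J` on, and item `j` is sampled if its word is divisible by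
`2 ^ i`. -/
def hitCount (ω : ℕ → Fin (2 ^ w)) (A : Finset ℕ) (i J start R : ℕ) : ℕ :=
  {r ∈ Finset.range R | ∃ j ∈ A, 2 ^ i ∣ (ω (start + r * J + j) : ℕ)}.card

theorem hitCount_le (A : Finset ℕ) (start : ℕ) : hitCount ω A i J start R ≤ R :=
  (Finset.card_filter_le _ _).trans_eq (Finset.card_range R)

theorem hitCount_succ (A : Finset ℕ) (start : ℕ) :
    hitCount ω A i J start (R + 1) = hitCount ω A i J start R +
      if ∃ j ∈ A, 2 ^ i ∣ (ω (start + R * J + j) : ℕ) then 1 else 0 := by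
  rw [hitCount, Finset.range_add_one, Finset.filter_insert]
  split_ifs
  · rw [Finset.card_insert_of_notMem (by simp), hitCount]
  · rfl

theorem run_round (hs : HasHits w S N E h s) (hscale : s.var .scale = 2 ^ i)
    (hfits : ∀ v < N, h v + 1 < 2 ^ w) :
    Run w ω (.sampleItems k ;; .search ;; .tally) s ((N + E.size) * 200 + 34) fun t =>
      Frame S [.edge, .queueHead, .queueLen, .pos, .vertex, .word] [.mark, .queue, .hits]
        (k.count N E) s t ∧
      HasHits w S N E (fun v => h v + if ∃ j ∈ itemsReaching N E k v,
        2 ^ i ∣ (ω (s.drawn + j) : ℕ) then 1 else 0) t := by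
  have hcount : k.count N E ≤ N + E.size := by cases k <;> simp [ItemKind.count]
  refine ((run_sampleItems hs.toHasGraph hs.arr_mark hscale).seq fun t ⟨hframe₁, l₀, hl₀, hmem₀⟩ =>
    (run_search (hs.toHasLists.of_frame hframe₁) hl₀).seq (B₂ := N * 60 + 6)
      fun u ⟨hframe₂, l, hl, hmem⟩ => ?_).mono
      (by omega) fun _ => id
  have hframe : Frame S [.edge, .queueHead, .queueLen, .pos, .vertex, .word] [.mark, .queue, .hits]
    (k.count N E) s u := hframe₁.mono.trans hframe₂.mono
  have hu : HasLists w S N E u := (hs.toHasLists.of_frame hframe₁).of_frame hframe₂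
  have hhits : ∀ v < N, u.arr S .hits v = h v := fun v hv => by
    have hvS := hv.trans_le hs.vertices_le
    rw [hframe₂.arr _ hvS, hframe₁.arr _ hvS, hs.arr_hits v hv]
  refine (run_tally hu.toHasGraph fun v hv => ?_).mono le_rfl fun t ⟨hframe₃, harr⟩ =>
    ⟨hframe.trans hframe₃.mono, hu.of_frame hframe₃, fun v hv => (harr v hv).2, fun v hv => ?_⟩
  · rw [hhits v hv, hl.arr_mark v hv]
    split_ifs <;> linarith [hfits v hv]
  · have hiff : v ∈ l ↔ ∃ j ∈ itemsReaching N E k v, 2 ^ i ∣ (ω (s.drawn + j) : ℕ) := by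
      rw [hmem]
      simp only [hmem₀, itemsReaching, Finset.mem_filter, Finset.mem_range]
      constructor
      · rintro ⟨u, ⟨j, hj, rfl, hdvd⟩, hreach⟩
        exact ⟨j, ⟨hj, hreach⟩, hdvd⟩
      · rintro ⟨j, ⟨hj, hreach⟩, hdvd⟩
        exact ⟨_, ⟨j, hj, rfl, hdvd⟩, hreach⟩
    simp only [(harr v hv).1, hhits v hv, hl.arr_mark v hv, hiff]

theorem run_countHits (hs : HasHits w S N E 0 s) (hscale : s.var .scale = 2 ^ i)
    (hreps : s.var .reps = R) (hR : R < 2 ^ w) :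
    Run w ω (.countHits k) s (R * ((N + E.size) * 200 + 42) + 6) fun t =>
      Frame S [.rep, .edge, .queueHead, .queueLen, .pos, .vertex, .word] [.mark, .queue, .hits]
        (R * k.count N E) s t ∧
      HasHits w S N E
        (fun v => hitCount ω (itemsReaching N E k v) i (k.count N E) s.drawn R) t := by
  refine Run.count (fun r t =>
    Frame S [.rep, .edge, .queueHead, .queueLen, .pos, .vertex, .word] [.mark, .queue, .hits]
      (r * k.count N E) s t ∧
    HasHits w S N E (fun v => hitCount ω (itemsReaching N E k v) i (k.count N E) s.drawn r) t)
    (by decide) hR hreps ⟨by simpa using (Frame.refl ..).set _ _,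
      hs.of_frame (vs := [.rep]) (as := []) ((Frame.refl ..).set _ _)⟩ ?_
  rintro r hr t ⟨hframe, ht⟩ hrep
  refine (run_round ht ((hframe.var .scale).trans hscale) fun v _ => ?_).mono le_rfl
    fun u ⟨hframe', hu⟩ => ⟨(hframe'.var .rep).trans hrep, hframe'.var .reps, ?_, ?_⟩
  · exact (Nat.succ_le_succ (hitCount_le _ _)).trans_lt (by omega)
  · rw [add_one_mul]
    exact (hframe.trans hframe'.mono).set _ _
  · simp only [hitCount_succ, ← hframe.drawn]
    exact hu.of_frame ((Frame.refl S [.rep] [] u).set _ _)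

theorem wp_concludeVertex {Q : State → Prop} {v x : ℕ} (hs : HasGraph w S N E s)
    (hscale : s.var .scale = 2 ^ i) (hreps : s.var .reps = R) (hthr : s.var .threshold = thr)
    (hpos : s.var .pos = v) (hv : v < N) (hhits : s.arr S .hits v = x)
    (hfits : 2 * (x * 2 ^ i) + 2 * R < 2 ^ w)
    (hQ : ∀ t, Frame S [] [.hits, .estimate k] 0 s t →
      (∀ u < N, t.arr S .hits u = if u = v then 0 else s.arr S .hits u) →
      (∀ u < N, t.arr S (.estimate k) u =
        if u = v ∧ thr ≤ x then scaledCount R i x else s.arr S (.estimate k) u) → Q t) :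
    (Prog.concludeVertex k).wp w ω Q s := by
  have hvertices := hs.vertices_le
  have hS := hs.fits
  have hvS : v < S := by omega
  have hx : (Expr.arr .hits (.var .pos)).value w s = x :=
    (hs.value_arr .hits (Expr.value_var hpos) hvS).trans hhits
  have hframe := Frame.refl S [] [.hits, .estimate k] s
  refine wp_seq ⟨fun hne => ?_, fun heq => ?_⟩
  · rw [Expr.value_lt_ne_zero, hx, Expr.value_var hthr] at hne
    refine wp_put (ω := ω) hs.toLayout hpos hvS (Expr.value_ofNat (k := 0) (by omega))
      (hQ _ (hframe.put .hits hvS) (fun u hu => ?_) fun u hu => ?_) <;>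
    rw [State.arr_put hvS (by omega)]
    · simp
    · simp [hne]
  · have hle : thr ≤ x := by
      rwa [← not_ne_iff, Expr.value_lt_ne_zero, hx, Expr.value_var hthr, not_lt] at heq
    have hvalue : ((2 * (.arr .hits (.var .pos) * .var .scale) + .var .reps) /
        (2 * .var .reps) : Expr).value w s = scaledCount R i x := by
      have htwo := Expr.value_ofNat (s := s) (k := 2) (by omega : 2 < 2 ^ w)
      exact Expr.value_div (Expr.value_add (Expr.value_mul htwo (Expr.value_mul hx
        (Expr.value_var hscale) (by omega)) (by omega)) (Expr.value_var hreps) (by omega))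
        (Expr.value_mul htwo (Expr.value_var hreps) (by omega))
    have hframe' := hframe.put (y := scaledCount R i x) (.estimate k) hvS
    refine wp_put (ω := ω) hs.toLayout hpos hvS hvalue <|
      wp_put (hs.of_frame hframe').toLayout hpos hvS (Expr.value_ofNat (k := 0) (by omega)) <|
      hQ _ (hframe'.put .hits hvS) (fun u hu => ?_) fun u hu => ?_ <;>
    rw [State.arr_put hvS (by omega), State.arr_put hvS (by omega)] <;> simp [hle]

theorem run_conclude (hs : HasHits w S N E h s) (hscale : s.var .scale = 2 ^ i)
    (hreps : s.var .reps = R) (hthr : s.var .threshold = thr)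
    (hfits : ∀ v < N, 2 * (h v * 2 ^ i) + 2 * R < 2 ^ w) :
    Run w ω (.conclude k) s (N * 80 + 6) fun t =>
      Frame S [.pos] [.hits, .estimate k] 0 s t ∧ HasHits w S N E 0 t ∧
      ∀ v < N, t.arr S (.estimate k) v =
        if h v < thr then s.arr S (.estimate k) v else scaledCount R i (h v) := by
  have hvertices := hs.vertices_le
  have hS := hs.fits
  have hedges := hs.edges_le
  refine (Run.count (B := 72) (fun j t => Frame S [.pos] [.hits, .estimate k] 0 s t ∧
    (∀ v < N, t.arr S .hits v = if v < j then 0 else h v) ∧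
    ∀ v < N, t.arr S (.estimate k) v =
      if v < j ∧ thr ≤ h v then scaledCount R i (h v) else s.arr S (.estimate k) v)
    (by decide) (by omega) hs.vertexCount
    ⟨(Frame.refl ..).set _ _, by simpa using hs.arr_hits, by simp⟩ ?_).mono le_rfl ?_
  · rintro j hj t ⟨hframe, hhits, hestimate⟩ hpos
    refine Run.of_wp (wp_concludeVertex (hs.toHasGraph.of_frame hframe)
      ((hframe.var .scale).trans hscale) ((hframe.var .reps).trans hreps)
      ((hframe.var .threshold).trans hthr) hpos hj ((hhits j hj).trans (if_neg (lt_irrefl j)))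
      (hfits j hj) fun u hframe' hhits' hestimate' => ⟨(hframe'.var .pos).trans hpos,
        hframe'.var .vertexCount, (hframe.trans hframe'.mono).set _ _, fun v hv => ?_,
        fun v hv => ?_⟩) (by cases k <;> decide)
    · rw [State.arr_set, hhits' v hv, hhits v hv]
      split_ifs <;> first | rfl | omega
    · rw [State.arr_set, hestimate' v hv, hestimate v hv]
      obtain rfl | hvj := eq_or_ne v j
      · simp
      · simp [hvj, hvj.le_iff_lt]
  · rintro t ⟨hframe, hhits, hestimate⟩
    have ht : HasLists w S N E t := hs.toHasLists.of_frame hframe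
    refine ⟨hframe, ⟨ht, fun v hv => ?_, fun v hv => by simp [hhits v hv, hv]⟩, fun v hv => ?_⟩
    · rw [hframe.arr .mark (by omega), hs.arr_mark v hv]
    · rw [hestimate v hv, ← ite_not]
      simp [hv]

theorem run_level (hs : HasHits w S N E 0 s) (hreps : s.var .reps = R)
    (hlevel : s.var .level = i) (hthr : s.var .threshold = thr) (hi : i < w)
    (hfits : 2 * (R * 2 ^ i) + 2 * R < 2 ^ w) :
    Run w ω (.runLevel k) s (R * ((N + E.size) * 200 + 42) + N * 80 + 16) fun t =>
      Frame S [.scale, .rep, .edge, .queueHead, .queueLen, .pos, .vertex, .word]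
        [.mark, .queue, .hits, .estimate k] (R * k.count N E) s t ∧
      HasHits w S N E 0 t ∧
      ∀ v < N, t.arr S (.estimate k) v =
        let c := hitCount ω (itemsReaching N E k v) i (k.count N E) s.drawn R
        if c < thr then s.arr S (.estimate k) v else scaledCount R i c := by
  have hframe₁ := (Frame.refl S [.scale] [] s).set .scale (2 ^ i)
  have hscale : (s.set .scale (2 ^ i)).var .scale = 2 ^ i := by simp
  have hhits v := Nat.mul_le_mul_right (2 ^ i) <| hitCount_le (ω := ω) (i := i)
    (J := k.count N E) (R := R) (itemsReaching N E k v) (s.set .scale (2 ^ i)).drawn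
  refine (Run.of_wp_seq <| wp_set (Expr.value_shl_one (Expr.value_var hlevel) hi) <|
    (run_countHits (hs.of_frame hframe₁) hscale ((hframe₁.var .reps).trans hreps) (by omega)).seq
      fun t ⟨hframe₂, ht⟩ => (run_conclude ht ((hframe₂.var .scale).trans hscale)
        (((hframe₂.var .reps).trans (hframe₁.var .reps)).trans hreps)
        (((hframe₂.var .threshold).trans (hframe₁.var .threshold)).trans hthr)
        fun v _ => (by have := hhits v; omega)).mono le_rfl fun u ⟨hframe₃, hu, hestimate⟩ =>
          ⟨?frame, hu, fun v hv => ?estimate⟩).mono ?time fun _ => id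
  case frame => simpa using (hframe₁.mono.trans hframe₂.mono).trans hframe₃.mono
  case estimate =>
    rw [hestimate v hv, hframe₂.arr _ (hv.trans_le hs.vertices_le)]
    rfl
  case time =>
    simp only [Prog.set, Prog.time, Expr.cost, Expr.var]
    omega

theorem run_estimate (hs : HasHits w S N E 0 s) (hreps : s.var .reps = R)
    (hlevels : s.var .levels = I) (hthr : s.var .threshold = thr)
    (hestimate : ∀ v < N, s.arr S (.estimate k) v = 0)
    (hI : I < w) (hfits : ∀ i < I, 2 * (R * 2 ^ i) + 2 * R < 2 ^ w) :
    Run w ω (.estimate k) s (I * ((R + 1) * ((N + E.size) * 200 + 42)) + 6) fun t =>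
      Frame S [.level, .scale, .rep, .edge, .queueHead, .queueLen, .pos, .vertex, .word]
        [.mark, .queue, .hits, .estimate k] (I * (R * k.count N E)) s t ∧
      HasHits w S N E 0 t ∧
      ∀ v < N, t.arr S (.estimate k) v = levelEstimate R thr (fun i => hitCount ω
        (itemsReaching N E k v) i (k.count N E) (s.drawn + i * (R * k.count N E)) R) I := by
  refine (Run.count (B := R * ((N + E.size) * 200 + 42) + N * 80 + 16) (fun i t =>
    Frame S [.level, .scale, .rep, .edge, .queueHead, .queueLen, .pos, .vertex, .word]
      [.mark, .queue, .hits, .estimate k] (i * (R * k.count N E)) s t ∧ HasHits w S N E 0 t ∧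
    ∀ v < N, t.arr S (.estimate k) v = levelEstimate R thr (fun i => hitCount ω
      (itemsReaching N E k v) i (k.count N E) (s.drawn + i * (R * k.count N E)) R) i)
    (by decide) (hI.trans Nat.lt_two_pow_self) hlevels ⟨by simpa using (Frame.refl ..).set _ _,
      hs.of_frame (vs := [.level]) (as := []) ((Frame.refl ..).set _ _), hestimate⟩ ?_).mono ?_
      fun _ => id
  · rintro i hi t ⟨hframe, ht, hestimate⟩ hlevel
    refine (run_level ht ((hframe.var .reps).trans hreps) hlevel
      ((hframe.var .threshold).trans hthr) (hi.trans hI) (hfits i hi)).mono le_rfl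
      fun u ⟨hframe', hu, hestimate'⟩ => ⟨(hframe'.var .level).trans hlevel, hframe'.var .levels,
        ?_, hu.of_frame ((Frame.refl S [.level] [] u).set _ _), fun v hv => ?_⟩
    · rw [add_one_mul]
      exact (hframe.trans hframe'.mono).set _ _
    · rw [State.arr_set, hestimate' v hv, hestimate v hv, hframe.drawn, levelEstimate]
  · gcongr
    rw [add_one_mul]
    omega

end WordRAM

namespace WordRAM

variable {w S N n l a b c R I : ℕ} {ω : ℕ → Fin (2 ^ w)} {E : EdgeSeq} {s t : State}

theorem size_eq_size_half_add_one (h : n ≠ 0) : n.size = (n / 2).size + 1 := by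
  conv_lhs => rw [← Nat.bit_bodd_div2 n]
  rw [Nat.size_bit (by rwa [Nat.bit_bodd_div2]), Nat.div2_val]

theorem run_sizeLoop (hs : s.var .size = 0) (hw : 1 < w) (hsize : (s.var .word).size < w) :
    Run w ω (.loop (.var .word) (.set .word (.var .word / 2) ;; .set .size (.var .size + 1))) s
      ((s.var .word).size * 10 + 2) fun t =>
        Frame S [.word, .size] [] 0 s t ∧ t.var .size = (s.var .word).size := by
  have hpow : w < 2 ^ w := Nat.lt_two_pow_self
  refine (Run.loop (B := 8) (fun κ t => Frame S [.word, .size] [] 0 s t ∧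
    κ = (t.var .word).size ∧ κ + t.var .size = (s.var .word).size) ⟨.refl .., rfl, by rw [hs]; rfl⟩
    ?_ ?_).mono (by simp only [Expr.cost, Expr.var]; omega) fun _ => id
  · rintro κ t ⟨hframe, hκ, hsum⟩ hword
    have hhalf := size_eq_size_half_add_one (show t.var .word ≠ 0 from hword)
    refine Run.of_wp (wp_seq <| wp_set (x := t.var .word / 2)
      (Expr.value_div rfl (Expr.value_ofNat (k := 2) (by omega))) <| wp_set (x := t.var .size + 1)
      (Expr.value_add rfl (Expr.value_ofNat (k := 1) (by omega))
        (by omega)) ⟨κ - 1, by omega, (hframe.set _ _).set _ _, ?_, ?_⟩) (by decide)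
    · simp only [State.var_set, reduceCtorEq, ↓reduceIte]
      omega
    · simp only [State.var_set, ↓reduceIte]
      omega
  · rintro κ t ⟨hframe, hκ, hsum⟩ hword
    rw [Expr.value_var rfl] at hword
    rw [hword, Nat.size_zero] at hκ
    exact ⟨hframe, by omega⟩

theorem run_readHeader (hw : 1 < w) (hsize : (s.mem 0).size < w) :
    Run w ω .readHeader s ((s.mem 0).size * 10 + 13) fun t =>
      Frame S [.vertexCount, .edgeCount, .word, .size] [] 0 s t ∧ t.var .vertexCount = s.mem 1 ∧
        t.var .edgeCount = s.mem 2 ∧ t.var .size = (s.mem 0).size := by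
  have hpow : w < 2 ^ w := Nat.lt_two_pow_self
  have hload : ∀ k ≤ 2, ∀ t : State, t.mem = s.mem → (Expr.load (.const k)).value w t = s.mem k :=
    fun k hk t ht => by rw [Expr.value, Expr.value_const (by omega), ht]
  refine (Run.of_wp_seq <| wp_set (hload 1 (by omega) _ rfl) <| Run.of_wp_seq <|
    wp_set (hload 2 le_rfl _ rfl) <| Run.of_wp_seq <| wp_set (hload 0 (by omega) _ rfl) <|
    Run.of_wp_seq <| wp_set (Expr.value_ofNat (k := 0) (by omega)) <|
    (run_sizeLoop (S := S) (by simp) hw (by simpa using hsize)).mono le_rfl ?_).mono ?_ fun _ => id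
  · rintro t ⟨hframe, ht⟩
    refine ⟨?_, ?_, ?_, ?_⟩
    · simpa using ((((Frame.refl S [.vertexCount, .edgeCount, .word, .size] [] s).set .vertexCount
        _).set .edgeCount _).set .word _ |>.set .size _).trans hframe.mono
    · simp [hframe.var .vertexCount]
    · simp [hframe.var .edgeCount]
    · simpa using ht
  · simp only [Prog.set, Prog.time, Expr.cost, State.var_set, reduceCtorEq, ↓reduceIte]
    omega

theorem run_setParameters (hs : s.var .size = l) (hl : 0 < l) (hw : 3 * l < w)
    (ha : a * l < 2 ^ w) (hb : b * l < 2 ^ w) (hc : c * l < 2 ^ w) :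
    Run w ω (.setParameters a b c) s 18 fun t =>
      Frame S [.stride, .reps, .levels, .threshold] [] 0 s t ∧ t.var .stride = 2 ^ (3 * l) ∧
        t.var .reps = a * l ∧ t.var .levels = b * l ∧ t.var .threshold = c * l := by
  have hpow : w < 2 ^ w := Nat.lt_two_pow_self
  have hproduct : ∀ x, x * l < 2 ^ w → ∀ t : State, t.var .size = l →
      (Expr.const x * .var .size).value w t = x * l := fun x hx t ht =>
    Expr.value_mul (Expr.value_const ((Nat.le_mul_of_pos_right x hl).trans_lt hx)) ht hx
  refine Run.of_wp (wp_seq <| wp_set (Expr.value_shl_one (Expr.value_mul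
    (Expr.value_ofNat (k := 3) (by omega)) hs (by omega)) hw) <|
    wp_seq <| wp_set (hproduct a ha _ (by simpa using hs)) <|
    wp_seq <| wp_set (hproduct b hb _ (by simpa using hs)) <|
    wp_set (hproduct c hc _ (by simpa using hs)) ⟨?_, by simp⟩) le_rfl
  exact (((Frame.refl ..).set _ _).set _ _ |>.set _ _).set _ _

/-- The memory holds the number `n` and a graph with `N` vertices and the edges `E`, and nothing
else. -/
structure HoldsInput (n N : ℕ) (E : EdgeSeq) (s : State) : Prop where
  mem_zero : s.mem 0 = n
  mem_one : s.mem 1 = N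
  mem_two : s.mem 2 = E.size
  mem_tail : ∀ f < E.size, s.mem (3 + 2 * f) = E.tail f
  mem_head : ∀ f < E.size, s.mem (4 + 2 * f) = E.head f
  mem_eq_zero : ∀ x, 2 * E.size + 3 ≤ x → s.mem x = 0
  tail_lt : ∀ f < E.size, E.tail f < N
  head_lt : ∀ f < E.size, E.head f < N

/-- Words of length `w` suffice for a graph with `N` vertices and `m` edges and for the parameters
`a`, `b`, `c`. -/
structure Fits (w a b c n N m : ℕ) : Prop where
  size_pos : 0 < n.size
  stride_le : 3 * n.size + 3 ≤ w
  vertices_le : N ≤ 2 ^ (3 * n.size)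
  edges_le : 2 * m + 3 ≤ 2 ^ (3 * n.size)
  levels_lt : b * n.size < w
  threshold_le : c ≤ a
  hits_lt : 2 * (a * n.size * 2 ^ (b * n.size)) + 2 * (a * n.size) < 2 ^ w

theorem run_prepare (hf : Fits w a b c n N E.size) (hs : HoldsInput n N E s) :
    Run w ω (.prepare a b c) s (n.size * 10 + 31) fun t =>
      HasGraph w (2 ^ (3 * n.size)) N E t ∧ t.var .reps = a * n.size ∧
        t.var .levels = b * n.size ∧ t.var .threshold = c * n.size ∧ t.drawn = s.drawn ∧
        ∀ e ≠ Arr.input, ∀ v < N, t.arr (2 ^ (3 * n.size)) e v = 0 := by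
  obtain ⟨hn, hw, hN, hE, hb, hca, hhits⟩ := hf
  obtain ⟨hnum, hcount, hedges, htail, hhead, hzero, htail_lt, hhead_lt⟩ := hs
  have hpow : w < 2 ^ w := Nat.lt_two_pow_self
  have hcl : c * n.size ≤ a * n.size := Nat.mul_le_mul_right _ hca
  have hfits : 8 * 2 ^ (3 * n.size) ≤ 2 ^ w := by
    rw [show 8 = 2 ^ 3 by rfl, ← pow_add]
    exact Nat.pow_le_pow_right two_pos (by omega)
  subst hnum
  refine (run_readHeader (S := 2 ^ (3 * (s.mem 0).size)) (by omega) (by omega)).seq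
    fun t ⟨hframe, hcountVar, hedgesVar, hsize⟩ =>
    (run_setParameters (S := 2 ^ (3 * (s.mem 0).size)) hsize hn (by omega) (by omega) (by omega)
      (by omega)).mono le_rfl
    fun u ⟨hframe', hstride, hreps, hlevels, hthr⟩ => ?_
  have hu : Frame (2 ^ (3 * (s.mem 0).size)) [.vertexCount, .edgeCount, .word, .size, .stride,
    .reps, .levels, .threshold] [] 0 s u := hframe.mono.trans hframe'.mono
  have hinput : ∀ x < 2 ^ (3 * (s.mem 0).size),
      u.arr (2 ^ (3 * (s.mem 0).size)) .input x = s.mem x := fun x hx => by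
    rw [hu.arr .input hx, State.arr, Arr.index, zero_mul, zero_add]
  refine ⟨⟨⟨hstride, hfits⟩, hN, hE, htail_lt, hhead_lt,
    by rw [hframe'.var .vertexCount, hcountVar, hcount],
    by rw [hframe'.var .edgeCount, hedgesVar, hedges],
    fun f hf => by rw [hinput _ (by omega), htail f hf],
    fun f hf => by rw [hinput _ (by omega), hhead f hf]⟩, hreps, hlevels, hthr, hu.drawn,
    fun e he v hv => ?_⟩
  have hindex : 1 ≤ e.index := Nat.one_le_iff_ne_zero.2 fun h => he (Arr.index_injective h)
  have hblock := Nat.mul_le_mul_right (2 ^ (3 * (s.mem 0).size)) hindex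
  rw [hu.arr e (hv.trans_le hN)]
  exact hzero _ (by omega)

theorem run_writeOutput (hs : Layout w S s) (hS : 0 < S) :
    Run w ω .writeOutput s 20 fun t =>
      t.mem = s.mem ∧ ∀ k, t.var (.output k) = (Arr.estimate k).index * S := by
  have haddress : ∀ k, ∀ t, Layout w S t →
      (Expr.adr (.estimate k) 0).value w t = (Arr.estimate k).index * S := fun k t ht =>
    ht.value_adr _ (Expr.value_ofNat (k := 0) (by positivity)) hS
  refine Run.of_wp (wp_seq <| wp_set (haddress _ _ hs) <| wp_set (haddress _ _ <|
    hs.of_frame (vs := [.output .vertex]) ((Frame.refl _ _ [] s).set _ _)) ⟨rfl, ?_⟩) (by decide)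
  rintro (_ | _) <;> simp

/-- The number of random words that are drawn before the items of a kind are sampled. -/
def ItemKind.drawsBefore (N R I : ℕ) : ItemKind → ℕ
  | .vertex => 0
  | .edge => I * (R * N)

/-- The number of rounds at level `i` in which an item of kind `k` is sampled whose owner reaches
the vertex `v`. -/
noncomputable def levelHits (ω : ℕ → Fin (2 ^ w)) (N : ℕ) (E : EdgeSeq) (R I : ℕ) (k : ItemKind)
    (v i : ℕ) : ℕ :=
  hitCount ω (itemsReaching N E k v) i (k.count N E)
    (k.drawsBefore N R I + i * (R * k.count N E)) R

theorem run_algorithm (hf : Fits w a b c n N E.size) (hs : HoldsInput n N E s)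
    (hdrawn : s.drawn = 0) :
    Run w ω (.algorithm a b c) s (n.size * 10 + E.size * 60 +
      2 * (b * n.size * ((a * n.size + 1) * ((N + E.size) * 200 + 42))) + 70) fun t =>
      ∀ k, ∀ v < N, t.mem (t.var (.output k) + v) = levelEstimate (a * n.size) (c * n.size)
        (levelHits ω N E (a * n.size) (b * n.size) k v) (b * n.size) := by
  refine ((run_prepare hf hs).seq fun t ⟨ht, hreps, hlevels, hthr, hdrawn', hzero⟩ =>
    (run_buildLists ht (hzero .first (by simp))).seq fun u ⟨hframe, hu⟩ => ?_).mono
    (B := n.size * 10 + 31 + (E.size * 60 + 6 + (b * n.size * ((a * n.size + 1) *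
      ((N + E.size) * 200 + 42)) + 6 + (b * n.size * ((a * n.size + 1) *
      ((N + E.size) * 200 + 42)) + 6 + 20)))) (by omega) fun _ => id
  have hbound : ∀ i < b * n.size, 2 * (a * n.size * 2 ^ i) + 2 * (a * n.size) < 2 ^ w :=
    fun i hi => hf.hits_lt.trans_le' (by gcongr; exact one_le_two)
  have hzero' : ∀ e ∉ [Arr.input, .first, .next], ∀ v < N, u.arr (2 ^ (3 * n.size)) e v = 0 :=
    fun e he v hv => by
      simp only [List.mem_cons, List.not_mem_nil, or_false, not_or] at he
      rw [hframe.arr e (hv.trans_le ht.vertices_le) (by simp [he]), hzero e he.1 v hv]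
  have hhits : HasHits w (2 ^ (3 * n.size)) N E 0 u :=
    ⟨hu, hzero' .mark (by simp), hzero' .hits (by simp)⟩
  refine (run_estimate hhits ((hframe.var .reps).trans hreps) ((hframe.var .levels).trans hlevels)
    ((hframe.var .threshold).trans hthr) (hzero' (.estimate .vertex) (by simp)) hf.levels_lt
    hbound).seq fun u₁ ⟨hframe₁, hu₁, hvertex⟩ => ?_
  refine (run_estimate hu₁ ((hframe₁.var .reps).trans ((hframe.var .reps).trans hreps))
    ((hframe₁.var .levels).trans ((hframe.var .levels).trans hlevels))
    ((hframe₁.var .threshold).trans ((hframe.var .threshold).trans hthr))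
    (fun v hv => (hframe₁.arr _ (hv.trans_le hu.vertices_le)).trans
      (hzero' (.estimate .edge) (by simp) v hv)) hf.levels_lt hbound).seq
    fun u₂ ⟨hframe₂, hu₂, hedge⟩ => (run_writeOutput hu₂.toLayout (by positivity)).mono le_rfl
    fun u₃ ⟨hmem, houtput⟩ k v hv => ?_
  have hdrawn_u : u.drawn = 0 := (hframe.drawn.trans hdrawn').trans hdrawn
  rw [houtput, hmem]
  cases k with
  | vertex =>
    refine (hframe₂.arr (.estimate .vertex) (hv.trans_le hu.vertices_le)).trans ?_
    rw [hvertex v hv, hdrawn_u]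
    rfl
  | edge =>
    refine (hedge v hv).trans ?_
    rw [hframe₁.drawn, hdrawn_u, zero_add]
    rfl

end WordRAM

section Frequency

open MeasureTheory ProbabilityTheory

open scoped NNReal

variable {Ω : Type*} [MeasurableSpace Ω] {μ : Measure Ω} {n : ℕ} {η : ℝ}

theorem measureReal_le_abs_sum_range_le_of_iIndepFun {X : ℕ → Ω → ℝ} {c : ℝ≥0}
    (hX : iIndepFun X μ) (hsub : ∀ r < n, HasSubgaussianMGF (X r) c μ) (hη : 0 ≤ η) :
    μ.real {x | η ≤ |∑ r ∈ Finset.range n, X r x|} ≤ 2 * Real.exp (-η ^ 2 / (2 * n * c)) := by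
  have := hX.isProbabilityMeasure
  have hupper := HasSubgaussianMGF.measure_sum_range_ge_le_of_iIndepFun hX hsub hη
  have hlower := HasSubgaussianMGF.measure_sum_range_ge_le_of_iIndepFun
    (hX.comp (fun _ => Neg.neg) fun _ => measurable_neg) (fun r hr => (hsub r hr).neg) hη
  rw [two_mul]
  refine (measureReal_mono fun x hx => ?_).trans
    ((measureReal_union_le _ _).trans (add_le_add hupper hlower))
  simpa [le_abs] using hx

theorem hasSubgaussianMGF_indicator_sub [IsProbabilityMeasure μ] {A : Set Ω}
    (hA : MeasurableSet A) :
    HasSubgaussianMGF (fun x => A.indicator (fun _ => (1 : ℝ)) x - μ.real A) (1 / 4) μ := by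
  have h := hasSubgaussianMGF_of_mem_Icc (a := 0) (b := 1) (μ := μ)
    (measurable_const.indicator hA : Measurable (A.indicator fun _ => (1 : ℝ))).aemeasurable
    (ae_of_all _ fun x => by by_cases hx : x ∈ A <;> simp [hx])
  rw [integral_indicator_const _ hA, smul_eq_mul, mul_one] at h
  convert h
  simp only [sub_zero, nnnorm_one]
  norm_num

open Classical in
theorem measureReal_frequency_deviation_le {A : ℕ → Set Ω} (hA : ∀ r, MeasurableSet (A r))
    (hind : iIndepSet A μ) {p : ℝ} (hp : ∀ r, μ.real (A r) = p) (hn : 0 < n) (hη : 0 ≤ η) :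
    μ.real {x | η < |(({r ∈ Finset.range n | x ∈ A r}.card : ℕ) : ℝ) / n - p|} ≤
      2 * Real.exp (-2 * η ^ 2 * n) := by
  have := hind.isProbabilityMeasure
  have hn' : (0 : ℝ) < n := by exact_mod_cast hn
  have hX : iIndepFun (fun r x => (A r).indicator (fun _ => (1 : ℝ)) x - p) μ :=
    hind.iIndepFun_indicator.comp (fun _ y => y - p) fun _ => by fun_prop
  have hdev := measureReal_le_abs_sum_range_le_of_iIndepFun (n := n) hX
    (fun r _ => hp r ▸ hasSubgaussianMGF_indicator_sub (hA r)) (mul_nonneg hη hn'.le)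
  refine (measureReal_mono fun x hx => ?_).trans (hdev.trans_eq ?_)
  · have hsum : ∑ r ∈ Finset.range n, ((A r).indicator (fun _ => (1 : ℝ)) x - p) =
        (({r ∈ Finset.range n | x ∈ A r}.card : ℕ) / n - p) * n := by
      rw [sub_mul, div_mul_cancel₀ _ hn'.ne', Finset.sum_sub_distrib]
      simp [Set.indicator_apply, mul_comm]
    rw [Set.mem_ofPred_eq, hsum, abs_mul, abs_of_pos hn']
    exact mul_le_mul_of_nonneg_right (le_of_lt hx) hn'.le
  · push_cast
    field_simp
    ring_nf

theorem one_sub_measureReal_le [IsProbabilityMeasure μ] {A B : Set Ω} (h : Aᶜ ⊆ B) :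
    1 - μ.real A ≤ μ.real B := by
  rw [sub_le_iff_le_add', ← probReal_univ (μ := μ), ← Set.union_compl_self A]
  exact (measureReal_union_le _ _).trans (add_le_add_right (measureReal_mono h) _)

end Frequency

namespace WordRAM

open Function MeasureTheory ProbabilityTheory

variable {w i n d : ℕ}

theorem card_fin_dvd (hd : d ∣ n) (hpos : 0 < d) :
    ({x : Fin n | d ∣ (x : ℕ)} : Finset (Fin n)).card = n / d := by
  have hcount := Nat.count_modEq_card n hpos 0
  rw [Nat.zero_mod, Nat.mod_eq_zero_of_dvd hd, if_neg (lt_irrefl 0), add_zero,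
    Nat.count_eq_card_filter_range] at hcount
  rw [← hcount, ← Finset.card_map Fin.valEmbedding]
  congr 1
  ext y
  simp only [Finset.mem_map, Finset.mem_filter, Finset.mem_univ, true_and, Finset.mem_range,
    Nat.modEq_zero_iff_dvd]
  exact ⟨fun ⟨x, hx, hxy⟩ => hxy ▸ ⟨x.2, hx⟩, fun ⟨hy, hdy⟩ => ⟨⟨y, hy⟩, hdy, rfl⟩⟩

theorem uniformOfFintype_fin_dvd [NeZero n] (hd : d ∣ n) (hpos : 0 < d) :
    (PMF.uniformOfFintype (Fin n)).toMeasure.real {x | d ∣ (x : ℕ)} = 1 / d := by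
  classical
  obtain ⟨q, rfl⟩ := hd
  have hq : q ≠ 0 := right_ne_zero_of_mul (NeZero.ne (d * q))
  rw [Measure.real, PMF.toMeasure_uniformOfFintype_apply _ MeasurableSet.of_discrete,
    Fintype.card_fin,
    Fintype.card_of_subtype ({x | d ∣ (x : ℕ)} : Finset (Fin (d * q))) fun _ => by simp,
    card_fin_dvd (Dvd.intro q rfl) hpos, Nat.mul_div_cancel_left q hpos]
  simp only [Nat.cast_mul, ENNReal.toReal_div, ENNReal.toReal_mul, ENNReal.toReal_natCast]
  field_simp

instance (w : ℕ) : IsProbabilityMeasure (randomWords w) := by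
  unfold randomWords
  infer_instance

/-- The event that none of the random words with numbers in `B` is divisible by `2 ^ i`. -/
def missEvent (w i : ℕ) (B : Finset ℕ) : Set (ℕ → Fin (2 ^ w)) :=
  (B : Set ℕ).pi fun _ => {x | 2 ^ i ∣ (x : ℕ)}ᶜ

theorem measurableSet_missEvent (B : Finset ℕ) : MeasurableSet (missEvent w i B) :=
  MeasurableSet.pi B.countable_toSet fun _ _ => MeasurableSet.of_discrete

theorem randomWords_missEvent (hi : i ≤ w) (B : Finset ℕ) :
    (randomWords w).real (missEvent w i B) = (1 - 1 / 2 ^ i) ^ B.card := by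
  rw [Measure.real, randomWords, missEvent,
    Measure.infinitePi_pi _ fun _ _ => MeasurableSet.of_discrete, Finset.prod_const,
    ENNReal.toReal_pow, ← Measure.real, probReal_compl_eq_one_sub MeasurableSet.of_discrete,
    uniformOfFintype_fin_dvd (pow_dvd_pow 2 hi) (by positivity), Nat.cast_pow, Nat.cast_ofNat]

theorem iIndepSet_missEvent (hi : i ≤ w) {B : ℕ → Finset ℕ} (hB : Pairwise (Disjoint on B)) :
    iIndepSet (fun r => missEvent w i (B r)) (randomWords w) := by
  classical
  rw [iIndepSet_iff_meas_biInter fun r => measurableSet_missEvent (B r)]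
  intro s
  have hinter : ⋂ r ∈ s, missEvent w i (B r) = missEvent w i (s.biUnion B) := by
    ext ω
    simp only [missEvent, Set.mem_iInter, Set.mem_pi, Finset.mem_coe, Finset.mem_biUnion]
    exact ⟨fun h j ⟨r, hr, hj⟩ => h r hr j hj, fun h r hr j hj => h j ⟨r, hr, hj⟩⟩
  rw [hinter, ← ENNReal.toReal_eq_toReal_iff' (measure_ne_top _ _)
    (ENNReal.prod_ne_top fun _ _ => measure_ne_top _ _), ENNReal.toReal_prod]
  simp only [← measureReal_def, randomWords_missEvent hi, Finset.prod_pow_eq_pow_sum,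
    Finset.card_biUnion fun _ _ _ _ hrt => hB hrt]

variable {A : Finset ℕ} {J start R : ℕ}

theorem pairwise_disjoint_image_add_mul (hA : A ⊆ Finset.range J) :
    Pairwise (Disjoint on fun r => A.image fun j => start + r * J + j) := by
  intro r t hrt
  rw [onFun, Finset.disjoint_left]
  simp only [Finset.mem_image, not_exists, not_and, forall_exists_index, and_imp]
  rintro _ j hj rfl k hk h
  have hjJ := Finset.mem_range.1 (hA hj)
  have hkJ := Finset.mem_range.1 (hA hk)
  have hdiv : (k + J * t) / J = (j + J * r) / J := by
    congr 1
    linarith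
  rw [Nat.add_mul_div_left _ _ (by omega), Nat.add_mul_div_left _ _ (by omega),
    Nat.div_eq_of_lt hjJ, Nat.div_eq_of_lt hkJ] at hdiv
  omega

open Classical in
theorem hitCount_add_card_missEvent (ω : ℕ → Fin (2 ^ w)) :
    hitCount ω A i J start R + {r ∈ Finset.range R |
      ω ∈ missEvent w i (A.image fun j => start + r * J + j)}.card = R := by
  have hmiss : ∀ r, ω ∈ missEvent w i (A.image fun j => start + r * J + j) ↔
      ¬ ∃ j ∈ A, 2 ^ i ∣ (ω (start + r * J + j) : ℕ) := by
    simp [missEvent, Set.mem_pi]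
  simp only [hitCount, hmiss, Finset.card_filter_add_card_filter_not, Finset.card_range]

theorem measureReal_hitCount_deviation_le {η : ℝ} (hi : i ≤ w) (hA : A ⊆ Finset.range J)
    (hR : 0 < R) (hη : 0 ≤ η) :
    (randomWords w).real {ω | η < |(hitCount ω A i J start R : ℝ) / R - hitProb A.card i|} ≤
      2 * Real.exp (-2 * η ^ 2 * R) := by
  classical
  refine (measureReal_mono fun ω hω => ?_).trans <| measureReal_frequency_deviation_le
    (A := fun r => missEvent w i (A.image fun j => start + r * J + j))
    (fun r => measurableSet_missEvent _)
    (iIndepSet_missEvent hi (pairwise_disjoint_image_add_mul (start := start) hA))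
    (fun r => (randomWords_missEvent hi _).trans
      (congrArg _ (Finset.card_image_of_injective _ (add_right_injective _)))) hR hη
  have hR' : (R : ℝ) ≠ 0 := by exact_mod_cast hR.ne'
  have htotal : (hitCount ω A i J start R : ℝ) = R - ({r ∈ Finset.range R |
      ω ∈ missEvent w i (A.image fun j => start + r * J + j)}.card : ℕ) := by
    rw [eq_sub_iff_add_eq]
    exact_mod_cast hitCount_add_card_missEvent ω
  rw [Set.mem_ofPred_eq, htotal, hitProb, sub_div, div_self hR', sub_sub_sub_cancel_left,
    abs_sub_comm] at hω
  exact hω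

end WordRAM

section InputGraph

open Relation WordRAM

variable {N : ℕ} {G : Digraph (Fin N)} {L : List (Fin N × Fin N)} {k : ℕ} {u v : Fin N}

/-- The sequence of the edges in a list; tails and heads beyond the end of the list are `0`. -/
def EdgeSeq.ofList (L : List (Fin N × Fin N)) : EdgeSeq where
  tail k := (L.map fun e => (e.1 : ℕ)).getD k 0
  head k := (L.map fun e => (e.2 : ℕ)).getD k 0
  size := L.length

namespace EdgeSeq

theorem tail_ofList (hk : k < L.length) : (ofList L).tail k = L[k].1 := by
  simp [ofList, hk]

theorem head_ofList (hk : k < L.length) : (ofList L).head k = L[k].2 := by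
  simp [ofList, hk]

theorem tail_ofList_lt (hk : k < L.length) : (ofList L).tail k < N :=
  tail_ofList hk ▸ L[k].1.2

theorem head_ofList_lt (hk : k < L.length) : (ofList L).head k < N :=
  head_ofList hk ▸ L[k].2.2

theorem adj_ofList_iff (hL : G.IsEdgeList L) {x y : ℕ} :
    (ofList L).Adj x y ↔ ∃ a b : Fin N, G.Adj a b ∧ a = x ∧ b = y := by
  constructor
  · rintro ⟨k, hk, rfl, rfl⟩
    exact ⟨L[k].1, L[k].2, (hL.2 _ _).1 (List.getElem_mem hk), (tail_ofList hk).symm,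
      (head_ofList hk).symm⟩
  · rintro ⟨a, b, hab, rfl, rfl⟩
    obtain ⟨k, hk, hget⟩ := List.getElem_of_mem ((hL.2 a b).2 hab)
    exact ⟨k, hk, by rw [tail_ofList hk, hget], by rw [head_ofList hk, hget]⟩

theorem reflTransGen_adj_ofList_iff (hL : G.IsEdgeList L) :
    ReflTransGen (ofList L).Adj u v ↔ u ∈ G.ancestors v := by
  constructor
  · intro h
    suffices ∀ y, ReflTransGen (ofList L).Adj u y →
        ∃ b : Fin N, (b : ℕ) = y ∧ ReflTransGen G.Adj u b by
      obtain ⟨b, hb, hub⟩ := this v h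
      rwa [Fin.ext hb] at hub
    intro y h
    induction h with
    | refl => exact ⟨u, rfl, .refl⟩
    | tail _ hadj ih =>
      obtain ⟨b, rfl, hub⟩ := ih
      obtain ⟨a, c, hac, hab, hc⟩ := (adj_ofList_iff hL).1 hadj
      rw [← Fin.ext hab] at hub
      exact ⟨c, hc, hub.tail hac⟩
  · intro (h : ReflTransGen G.Adj u v)
    exact h.lift Fin.val fun a b hab => (adj_ofList_iff hL).2 ⟨a, b, hab, rfl, rfl⟩

end EdgeSeq

theorem getD_flatMap_two_mul (L : List (Fin N × Fin N)) (k : ℕ) :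
    (L.flatMap fun e => [(e.1 : ℕ), (e.2 : ℕ)]).getD (2 * k) 0 = (EdgeSeq.ofList L).tail k := by
  induction L generalizing k with
  | nil => rfl
  | cons e L ih =>
    cases k with
    | zero => rfl
    | succ k => exact ih k

theorem getD_flatMap_two_mul_add_one (L : List (Fin N × Fin N)) (k : ℕ) :
    (L.flatMap fun e => [(e.1 : ℕ), (e.2 : ℕ)]).getD (2 * k + 1) 0 =
      (EdgeSeq.ofList L).head k := by
  induction L generalizing k with
  | nil => rfl
  | cons e L ih =>
    cases k with
    | zero => rfl
    | succ k => exact ih k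

theorem length_le_sq (hL : G.IsEdgeList L) : L.length ≤ N * N := by
  simpa using hL.1.length_le_card

theorem length_encodeInput (n : ℕ) (L : List (Fin N × Fin N)) :
    (encodeInput n N L).length = 2 * L.length + 3 := by
  simp only [encodeInput, List.length_cons, List.length_flatMap, List.length_nil,
    List.map_const', List.sum_replicate, smul_eq_mul]
  ring

theorem getD_encodeInput_tail (n : ℕ) (L : List (Fin N × Fin N)) (k : ℕ) :
    (encodeInput n N L).getD (3 + 2 * k) 0 = (EdgeSeq.ofList L).tail k := by
  rw [← getD_flatMap_two_mul, add_comm]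
  rfl

theorem getD_encodeInput_head (n : ℕ) (L : List (Fin N × Fin N)) (k : ℕ) :
    (encodeInput n N L).getD (4 + 2 * k) 0 = (EdgeSeq.ofList L).head k := by
  rw [← getD_flatMap_two_mul_add_one, add_comm]
  rfl

theorem holdsInput_initial {w a b c n : ℕ} (hf : Fits w a b c n N L.length) :
    HoldsInput n N (.ofList L) (initial w (encodeInput n N L)) := by
  have hstride : 2 ^ (3 * n.size) < 2 ^ w :=
    Nat.pow_lt_pow_right one_lt_two (by have := hf.stride_le; omega)
  have hN : N < 2 ^ w := hf.vertices_le.trans_lt hstride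
  have hL : L.length < 2 ^ w := by have := hf.edges_le; omega
  have hn : n < 2 ^ w := (Nat.lt_size_self n).trans_le <|
    Nat.pow_le_pow_right two_pos (by have := hf.stride_le; omega)
  have hmem : ∀ x, (initial w (encodeInput n N L)).mem x =
      (encodeInput n N L).getD x 0 % 2 ^ w := fun _ => rfl
  refine ⟨Nat.mod_eq_of_lt hn, Nat.mod_eq_of_lt hN, Nat.mod_eq_of_lt hL, fun f hf => ?_,
    fun f hf => ?_, fun x hx => ?_, fun f => EdgeSeq.tail_ofList_lt,
    fun f => EdgeSeq.head_ofList_lt⟩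
  · rw [hmem, getD_encodeInput_tail, Nat.mod_eq_of_lt ((EdgeSeq.tail_ofList_lt hf).trans hN)]
  · rw [hmem, getD_encodeInput_head, Nat.mod_eq_of_lt ((EdgeSeq.head_ofList_lt hf).trans hN)]
  · rw [hmem, List.getD_eq_default _ _ (by rwa [length_encodeInput]), Nat.zero_mod]

theorem mem_itemsReaching_vertex_iff (hL : G.IsEdgeList L) {j : ℕ} :
    j ∈ itemsReaching N (.ofList L) .vertex v ↔ ∃ hj : j < N, ⟨j, hj⟩ ∈ G.ancestors v := by
  classical
  simp only [itemsReaching, Finset.mem_filter, Finset.mem_range]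
  exact ⟨fun ⟨hj, h⟩ => ⟨hj, (EdgeSeq.reflTransGen_adj_ofList_iff hL (u := ⟨j, hj⟩)).1 h⟩,
    fun ⟨hj, h⟩ => ⟨hj, (EdgeSeq.reflTransGen_adj_ofList_iff hL).2 h⟩⟩

theorem mem_itemsReaching_edge_iff (hL : G.IsEdgeList L) {j : ℕ} :
    j ∈ itemsReaching N (.ofList L) .edge v ↔
      ∃ hj : j < L.length, L[j].2 ∈ G.ancestors v := by
  classical
  simp only [itemsReaching, Finset.mem_filter, Finset.mem_range]
  refine exists_prop.symm.trans (exists_congr fun hj => ?_)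
  rw [← EdgeSeq.reflTransGen_adj_ofList_iff hL, ← EdgeSeq.head_ofList hj]
  rfl

theorem card_itemsReaching_vertex (hL : G.IsEdgeList L) (v : Fin N) :
    (itemsReaching N (.ofList L) .vertex v).card = (G.ancestors v).ncard := by
  rw [← Set.ncard_coe_finset]
  symm
  exact Set.ncard_congr (fun u _ => (u : ℕ))
    (fun u hu => (mem_itemsReaching_vertex_iff hL).2 ⟨u.2, hu⟩) (fun _ _ _ _ => Fin.ext)
    fun j hj => have ⟨hjN, hanc⟩ := (mem_itemsReaching_vertex_iff hL).1 hj
      ⟨⟨j, hjN⟩, hanc, rfl⟩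

theorem card_itemsReaching_edge (hL : G.IsEdgeList L) (v : Fin N) :
    (itemsReaching N (.ofList L) .edge v).card = (G.ancestorEdges v).ncard := by
  rw [← Set.ncard_coe_finset]
  refine Set.ncard_congr
    (fun j hj => L[j]'((mem_itemsReaching_edge_iff hL).1 hj).1) (fun j hj => ?_)
    (fun _ _ _ _ => hL.1.getElem_inj_iff.1) fun e ⟨hadj, _, hhead⟩ => ?_
  · obtain ⟨hjL, hhead⟩ := (mem_itemsReaching_edge_iff hL).1 hj
    have hadj : G.Adj L[j].1 L[j].2 := (hL.2 _ _).1 (List.getElem_mem hjL)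
    exact ⟨hadj, .head hadj hhead, hhead⟩
  · obtain ⟨k, hk, hget⟩ := List.getElem_of_mem ((hL.2 e.1 e.2).2 hadj)
    exact ⟨k, (mem_itemsReaching_edge_iff hL).2 ⟨hk, by rwa [hget]⟩, hget⟩

end InputGraph

namespace WordRAM

theorem log_le_size (n : ℕ) : Real.log n ≤ n.size := by
  obtain rfl | hn := Nat.eq_zero_or_pos n
  · simp
  calc Real.log n ≤ Real.log (2 ^ n.size) :=
        Real.log_le_log (by positivity) (by exact_mod_cast (Nat.lt_size_self n).le)
    _ = n.size * Real.log 2 := Real.log_pow _ _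
    _ ≤ n.size := mul_le_of_le_one_right (by positivity) (by linarith [Real.log_two_lt_d9])

theorem two_le_size {n : ℕ} (hn : 2 ≤ n) : 2 ≤ n.size := Nat.lt_size.2 (by simpa using hn)

theorem size_le_three_mul_log {n : ℕ} (hn : 2 ≤ n) : (n.size : ℝ) ≤ 3 * Real.log n := by
  have hsize := two_le_size hn
  have hpow : (2 : ℝ) ^ (n.size - 1) ≤ n := by exact_mod_cast Nat.lt_size.1 (by omega)
  have hlog := Real.log_le_log (by positivity) hpow
  rw [Real.log_pow, Nat.cast_sub (by omega), Nat.cast_one] at hlog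
  have hlog_two : Real.log 2 ≤ Real.log n :=
    Real.log_le_log two_pos (by exact_mod_cast hn)
  have htwo := Real.log_two_gt_d9
  rify at hsize
  nlinarith

theorem mul_le_two_pow {n D x : ℕ} (hn : 2 ≤ n) (hx : x ≤ n * n) :
    D * x ≤ 2 ^ ((D + 3) * n.size - 1) := by
  have hsize := two_le_size hn
  have hlt := (Nat.lt_size_self n).le
  calc D * x ≤ 2 ^ D * (2 ^ n.size * 2 ^ n.size) :=
        Nat.mul_le_mul Nat.lt_two_pow_self.le (hx.trans (Nat.mul_le_mul hlt hlt))
    _ = 2 ^ (D + (n.size + n.size)) := by rw [pow_add, pow_add]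
    _ ≤ 2 ^ ((D + 3) * n.size - 1) := Nat.pow_le_pow_right two_pos (by
      have hD : D ≤ D * n.size := Nat.le_mul_of_pos_right _ (by omega)
      rw [add_mul]
      omega)

theorem two_mul_sq_add_three_le {n : ℕ} (hn : 2 ≤ n) : 2 * (n * n) + 3 ≤ 2 ^ (3 * n.size) := by
  have hlt := Nat.lt_size_self n
  have hfour : 2 ^ 2 ≤ 2 ^ n.size := Nat.pow_le_pow_right two_pos (two_le_size hn)
  calc 2 * (n * n) + 3 ≤ 2 ^ 2 * ((n + 1) * (n + 1)) := by nlinarith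
    _ ≤ 2 ^ n.size * (2 ^ n.size * 2 ^ n.size) := by gcongr <;> omega
    _ = 2 ^ (3 * n.size) := by rw [← pow_add, ← pow_add]; congr 1; ring

theorem hits_lt_two_pow {a b l : ℕ} (hl : 2 ≤ l) :
    2 * (a * l * 2 ^ (b * l)) + 2 * (a * l) < 2 ^ ((a + b + 7) * l) := by
  have hal : a * l < 2 ^ (a * l) := Nat.lt_two_pow_self
  have hbl : 1 ≤ 2 ^ (b * l) := Nat.one_le_two_pow
  calc 2 * (a * l * 2 ^ (b * l)) + 2 * (a * l) ≤ 4 * (a * l * 2 ^ (b * l)) := by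
        linarith [Nat.le_mul_of_pos_right (a * l) hbl]
    _ < 4 * (2 ^ (a * l) * 2 ^ (b * l)) := by gcongr
    _ = 2 ^ (2 + (a * l + b * l)) := by ring
    _ ≤ 2 ^ ((a + b + 7) * l) := Nat.pow_le_pow_right two_pos (by nlinarith)

theorem fits_of_le {n N m a b c : ℕ} (hn : 2 ≤ n) (hN : N ≤ n) (hm : m ≤ N * N)
    (hc : c ≤ a) : Fits ((a + b + 7) * n.size) a b c n N m where
  size_pos := (two_le_size hn).trans' one_le_two
  stride_le := by nlinarith [two_le_size hn]
  vertices_le := by nlinarith [two_mul_sq_add_three_le hn]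
  edges_le := by nlinarith [two_mul_sq_add_three_le hn, Nat.mul_le_mul hN hN]
  levels_lt := Nat.mul_lt_mul_of_pos_right (by omega) ((two_le_size hn).trans' one_le_two)
  threshold_le := hc
  hits_lt := hits_lt_two_pow (two_le_size hn)

theorem algorithm_time_le {n N m a b : ℕ} (hn : 2 ≤ n) (hN : 1 ≤ N) (ha : 1 ≤ a) :
    ((n.size * 10 + m * 60 +
      2 * (b * n.size * ((a * n.size + 1) * ((N + m) * 200 + 42))) + 70 : ℕ) : ℝ) ≤
      9 * (968 * a * b + 140) * (N + m) * Real.log n ^ 2 := by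
  have hsize := two_le_size hn
  have hreps : a * n.size + 1 ≤ 2 * a * n.size := by nlinarith
  have hround : (N + m) * 200 + 42 ≤ 242 * (N + m) := by omega
  have hsq : n.size ≤ n.size ^ 2 := Nat.le_self_pow two_ne_zero _
  have hbound : n.size * 10 + m * 60 +
      2 * (b * n.size * ((a * n.size + 1) * ((N + m) * 200 + 42))) + 70 ≤
      (968 * a * b + 140) * (N + m) * n.size ^ 2 := by
    calc _ ≤ n.size ^ 2 * 140 * (N + m) +
          2 * (b * n.size * (2 * a * n.size * (242 * (N + m)))) := by
          have : 2 * (b * n.size * ((a * n.size + 1) * ((N + m) * 200 + 42))) ≤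
            2 * (b * n.size * (2 * a * n.size * (242 * (N + m)))) := by gcongr
          nlinarith
      _ = _ := by ring
  calc _ ≤ (((968 * a * b + 140) * (N + m) * n.size ^ 2 : ℕ) : ℝ) := Nat.cast_le.2 hbound
    _ = (968 * a * b + 140) * (N + m) * (n.size : ℝ) ^ 2 := by push_cast; ring
    _ ≤ (968 * a * b + 140) * (N + m) * (3 * Real.log n) ^ 2 := by
      gcongr
      exact size_le_three_mul_log hn
    _ = _ := by ring

theorem failure_bound_le {n N D e : ℕ} {d : ℝ} (hn : 2 ≤ n) (hN : N ≤ n) (hd : d ≤ e) (hD : 0 < D) :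
    2 * (N * ((D + 3) * n.size : ℕ)) * (2 * Real.exp (-2 * (1 / (D : ℝ) ^ 2) ^ 2 *
      (D * (D ^ 3 * (e + 2 * D + 7)) * n.size : ℕ))) ≤ 1 / (n : ℝ) ^ d := by
  have hlog := log_le_size n
  have hn₀ : (0 : ℝ) < n := by positivity
  have hD₀ : (0 : ℝ) < D := by exact_mod_cast hD
  have hl : (2 : ℝ) ≤ n.size := by exact_mod_cast two_le_size hn
  have hexp : -2 * (1 / (D : ℝ) ^ 2) ^ 2 * (D * (D ^ 3 * (e + 2 * D + 7)) * n.size : ℕ) =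
      -(2 * (e + 2 * D + 7) * n.size) := by
    push_cast
    field_simp
  set l : ℝ := (n.size : ℝ)
  have hN' : (N : ℝ) ≤ Real.exp l :=
    (Nat.cast_le.2 hN).trans ((Real.log_le_iff_le_exp hn₀).1 hlog)
  have hl' : l ≤ Real.exp l := by linarith [Real.add_one_le_exp l]
  have hD' : (4 * (D + 3) : ℝ) ≤ Real.exp (4 * (D + 3) * l) := by
    nlinarith [Real.add_one_le_exp (4 * (D + 3) * l)]
  have hnd : (n : ℝ) ^ d ≤ Real.exp (e * l) :=
    calc (n : ℝ) ^ d ≤ (n : ℝ) ^ (e : ℝ) :=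
          Real.rpow_le_rpow_of_exponent_le (by exact_mod_cast one_le_two.trans hn) hd
      _ = Real.exp (Real.log n * e) := Real.rpow_def_of_pos hn₀ _
      _ ≤ Real.exp (e * l) := by rw [mul_comm]; gcongr
  rw [hexp, le_div_iff₀ (by positivity)]
  calc 2 * (N * ((D + 3) * n.size : ℕ)) * (2 * Real.exp (-(2 * (e + 2 * D + 7) * l))) * (n : ℝ) ^ d
      = 4 * (D + 3) * l * N * (n : ℝ) ^ d * Real.exp (-(2 * (e + 2 * D + 7) * l)) := by
        push_cast
        ring
    _ ≤ Real.exp (4 * (D + 3) * l) * Real.exp l * Real.exp l * Real.exp (e * l) *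
        Real.exp (-(2 * (e + 2 * D + 7) * l)) := by gcongr
    _ = Real.exp (-e * l) := by
      simp only [← Real.exp_add]
      ring_nf
    _ ≤ 1 := by
      rw [Real.exp_le_one_iff]
      exact mul_nonpos_of_nonpos_of_nonneg (by simp) (by positivity)

end WordRAM

namespace WordRAM

open MeasureTheory

variable {w a b c n N R I : ℕ} {E : EdgeSeq} {η ε : ℝ} {G : Digraph (Fin N)}
  {L : List (Fin N × Fin N)}

/-- The event that some frequency of hits observed by the algorithm differs from the corresponding
probability by more than `η`. -/
def deviationEvent (w N : ℕ) (E : EdgeSeq) (R I : ℕ) (η : ℝ) : Set (ℕ → Fin (2 ^ w)) :=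
  {ω | ∃ k, ∃ v < N, ∃ i < I,
    η < |(levelHits ω N E R I k v i : ℝ) / R - hitProb (itemsReaching N E k v).card i|}

theorem itemsReaching_subset (k : ItemKind) (v : ℕ) :
    itemsReaching N E k v ⊆ Finset.range (k.count N E) := by
  classical
  exact Finset.filter_subset _ _

theorem measureReal_deviationEvent_le (hI : I ≤ w) (hR : 0 < R) (hη : 0 ≤ η) :
    (randomWords w).real (deviationEvent w N E R I η) ≤
      2 * (N * I) * (2 * Real.exp (-2 * η ^ 2 * R)) := by
  let items : Finset (ItemKind × ℕ × ℕ) :=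
    {.vertex, .edge} ×ˢ Finset.range N ×ˢ Finset.range I
  have hsub : deviationEvent w N E R I η ⊆ ⋃ p ∈ items, {ω | η <
      |(levelHits ω N E R I p.1 p.2.1 p.2.2 : ℝ) / R -
        hitProb (itemsReaching N E p.1 p.2.1).card p.2.2|} := by
    rintro ω ⟨k, v, hv, i, hi, hdev⟩
    refine Set.mem_biUnion (x := (k, v, i)) ?_ hdev
    cases k <;> simp [items, hv, hi]
  have hcard : items.card = 2 * (N * I) := by simp [items]
  refine (measureReal_mono hsub (measure_ne_top _ _)).trans <|
    (measureReal_biUnion_finset_le _ _).trans <|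
    (Finset.sum_le_card_nsmul _ _ _ fun p hp => measureReal_hitCount_deviation_le ?_
      (itemsReaching_subset _ _) hR hη).trans_eq ?_
  · simp only [items, Finset.mem_product, Finset.mem_range] at hp
    omega
  · rw [hcard, nsmul_eq_mul]
    push_cast
    rfl

theorem card_itemsReaching_le_sq (hL : G.IsEdgeList L) (hN : N ≤ n) (k : ItemKind) (v : ℕ) :
    (itemsReaching N (.ofList L) k v).card ≤ n * n := by
  have hcard : (itemsReaching N (.ofList L) k v).card ≤ k.count N (.ofList L) :=
    (Finset.card_le_card (itemsReaching_subset k v)).trans_eq (Finset.card_range _)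
  refine hcard.trans ?_
  cases k with
  | vertex => exact hN.trans (Nat.le_mul_self n)
  | edge => exact (length_le_sq hL).trans (Nat.mul_le_mul hN hN)

theorem correctOutput_of_notMem_deviationEvent {D : ℕ} {ω : ℕ → Fin (2 ^ w)} {t : State}
    (hε : 0 < ε) (hD : 8 ≤ D) (hDε : 24 / ε ≤ D) (hc : 0 < c) (hn : 2 ≤ n) (hN : N ≤ n)
    (hL : G.IsEdgeList L)
    (hω : ω ∉ deviationEvent w N (.ofList L) (D * c * n.size) ((D + 3) * n.size) (1 / D ^ 2))
    (ht : ∀ k, ∀ v < N, t.mem (t.var (.output k) + v) =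
      levelEstimate (D * c * n.size) (c * n.size) (levelHits ω N (.ofList L) (D * c * n.size)
        ((D + 3) * n.size) k v) ((D + 3) * n.size)) : CorrectOutput ε G t := by
  have hsize := two_le_size hn
  have hestimate : ∀ k, ∀ v < N, IsEstimate ε (itemsReaching N (.ofList L) k v).card
      (t.mem (t.var (.output k) + v)) := by
    intro k v hv
    rw [ht k v hv, mul_assoc]
    refine isEstimate_levelEstimate hε hD hDε (by positivity) (by positivity)
      (mul_le_two_pow hn (card_itemsReaching_le_sq hL hN k v)) fun i hi =>
      not_lt.1 fun hdev => hω ?_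
    exact ⟨k, v, hv, i, hi, by rwa [mul_assoc]⟩
  intro v
  rw [← card_itemsReaching_vertex hL, ← card_itemsReaching_edge hL]
  exact ⟨hestimate .vertex v v.2, hestimate .edge v v.2⟩

end WordRAM

theorem mainTheorem5_general (ε d : ℝ) (hε : 0 < ε) :
    ∃ (P : WordRAM.Prog) (c : ℕ) (C : ℝ), 0 < c ∧
      ∀ (n N : ℕ), 2 ≤ n → 1 ≤ N → N ≤ n →
      ∀ (G : Digraph (Fin N)) (L : List (Fin N × Fin N)), G.IsEdgeList L →
        (∀ ω : ℕ → Fin (2 ^ (c * Nat.size n)), ∃ (T : ℕ) (t : WordRAM.State),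
          WordRAM.Exec (c * Nat.size n) ω P
            (WordRAM.initial (c * Nat.size n) (encodeInput n N L)) T t ∧
          (T : ℝ) ≤ C * ((N : ℝ) + (L.length : ℝ)) * Real.log n ^ 2) ∧
        1 - 1 / (n : ℝ) ^ d ≤
          (WordRAM.randomWords (c * Nat.size n)).real
            {ω | ∃ (T : ℕ) (t : WordRAM.State),
              WordRAM.Exec (c * Nat.size n) ω P
                (WordRAM.initial (c * Nat.size n) (encodeInput n N L)) T t ∧
              CorrectOutput ε G t} := by
  obtain ⟨D, hD⟩ := exists_nat_ge (max 8 (24 / ε))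
  obtain ⟨hD8, hDε⟩ := max_le_iff.1 hD
  have hD8 : 8 ≤ D := by exact_mod_cast hD8
  obtain ⟨e, he⟩ := exists_nat_ge d
  set c := D ^ 3 * (e + 2 * D + 7)
  have hc : 0 < c := by positivity
  have hDc : 0 < D * c := by positivity
  refine ⟨.algorithm (D * c) (D + 3) c, D * c + (D + 3) + 7,
    9 * (968 * (D * c : ℕ) * (D + 3 : ℕ) + 140), by omega, fun n N hn hN hNn G L hL => ?_⟩
  have hfits := WordRAM.fits_of_le (b := D + 3) hn hNn (length_le_sq hL)
    (Nat.le_mul_of_pos_left c (by omega : 0 < D))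
  have hrun ω := WordRAM.run_algorithm (ω := ω) hfits (holdsInput_initial hfits) rfl
  refine ⟨fun ω => ?_, ?_⟩
  · obtain ⟨T, t, hexec, hT, -⟩ := hrun ω
    exact ⟨T, t, hexec, (Nat.cast_le.2 hT).trans (WordRAM.algorithm_time_le hn hN hDc)⟩
  · have hfailure := (WordRAM.measureReal_deviationEvent_le (N := N) (E := .ofList L)
      (η := 1 / (D : ℝ) ^ 2) hfits.levels_lt.le (Nat.mul_pos hDc hfits.size_pos)
      (by positivity)).trans (WordRAM.failure_bound_le hn hNn he (by omega))
    refine (sub_le_sub_left hfailure 1).trans (one_sub_measureReal_le fun ω hω => ?_)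
    obtain ⟨T, t, hexec, -, ht⟩ := hrun ω
    exact ⟨T, t, hexec,
      WordRAM.correctOutput_of_notMem_deviationEvent hε hD8 hDε hc hn hNn hL hω ht⟩

theorem mainTheorem5 (ε d : ℝ) (hε : 0 < ε) (hd : 1 ≤ d) :
    ∃ (P : WordRAM.Prog) (c : ℕ) (C : ℝ), 0 < c ∧
      ∀ (n N : ℕ), 2 ≤ n → 1 ≤ N → N ≤ n →
      ∀ (G : Digraph (Fin N)) (L : List (Fin N × Fin N)), G.IsDAG → G.IsEdgeList L →
        (∀ ω : ℕ → Fin (2 ^ (c * Nat.size n)), ∃ (T : ℕ) (t : WordRAM.State),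
          WordRAM.Exec (c * Nat.size n) ω P
            (WordRAM.initial (c * Nat.size n) (encodeInput n N L)) T t ∧
          (T : ℝ) ≤ C * ((N : ℝ) + (L.length : ℝ)) * Real.log n ^ 2) ∧
        1 - 1 / (n : ℝ) ^ d ≤
          (WordRAM.randomWords (c * Nat.size n)).real
            {ω | ∃ (T : ℕ) (t : WordRAM.State),
              WordRAM.Exec (c * Nat.size n) ω P
                (WordRAM.initial (c * Nat.size n) (encodeInput n N L)) T t ∧
              CorrectOutput ε G t} := by
  obtain ⟨P, c, C, hc, h⟩ := mainTheorem5_general ε d hε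
  exact ⟨P, c, C, hc, fun n N hn hN hNn G L _ hL => h n N hn hN hNn G L hL⟩
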